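/- **Conventions.** A *module* is an additive functor $M\colon\mathcal R\to\mathbf{Ab}$, where $\mathcal R$ is a skeletally small preadditive category. Let $\mathcal R\text{-mod}$ be the category of finitely presented $\mathcal R$-modules and let $\mathrm{Ab}(\mathcal R)=(\mathcal R\text{-mod},\mathbf{Ab})^{\mathrm{fp}}$, the category of finitely presented functors on it, be the free abelian category on $\mathcal R$. The module $M$ extends, uniquely up to isomorphism, to an exact functor $\widetilde M\colon\mathrm{Ab}(\mathcal R)\to\mathbf{Ab}$, namely $\widetilde M(F)=\varinjlim_{A\to M}F(A)$, where $A\to M$ runs over the homomorphisms from finitely presented modules to $M$. Let $\mathcal S_M=\{F:\widetilde M(F)=0\}$, a Serre subcategory of $\mathrm{Ab}(\mathcal R)$, let $\mathcal A(M)=\mathrm{Ab}(\mathcal R)/\mathcal S_M$, and let $\widehat M\colon\mathcal A(M)\to\mathbf{Ab}$ be the exact functor induced by $\widetilde M$. The module $M$ is *over a ring* if there are a ring $S$ with $1$ and an $S$-module $N$ (an additive functor to $\mathbf{Ab}$ from $S$, seen as a preadditive category with one object) that represent it, that is, if there is an equivalence $H\colon\mathcal A(M)\to\mathcal A(N)$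 with $\widehat N\circ H\cong\widehat M$. An *abelian subcategory* (possibly non-full, taken up to equivalence) of an abelian category $\mathcal A$ is an abelian category $\mathcal B$ with a faithful exact functor $I\colon\mathcal B\to\mathcal A$. It *contains an object $U$ and all its endomorphisms*, through $V\in\mathcal B$ and an isomorphism $e\colon IV\to U$, if every endomorphism of $IV$ is $I(g)$ for some endomorphism $g$ of $V$. An object $U$ of $\mathcal A$ is an *abelian generator* of $\mathcal A$ if $\mathcal A$ is the smallest abelian subcategory of $\mathcal A$ containing $U$ and all its endomorphisms; that is, for all such $(\mathcal B,I,V,e)$ there are a functor $s\colon\mathcal A\to\mathcal B$, a natural isomorphism $\eta\colon I\circ s\to\mathrm{id}_{\mathcal A}$ and an isomorphism $\sigma\colon sU\to V$ with $e\circ I(\sigma)=\eta_U$. **Proposition 5.1.** Let $M$ be a module. Then $M$ is over a ring if and only if some object $U$ of $\mathcal A(M)$ is an abelian generator of $\mathcal A(M)$. Likewise, there is a ring $S$ with $1$ such that $\mathcal A(M)$ is equivalent to a quotient of $\mathrm{Ab}(S)$ by a Serre subcategory if and only if some object $U$ of $\mathcal A(M)$ is an abelian generator of $\mathcal A(M)$.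 -/

import Mathlib

open CategoryTheory CategoryTheory.Limits Opposite

universe w v u

noncomputable section

set_option linter.unusedSectionVars false
namespace ModExact
section
variable {D : Type u} [SmallCategory D] [Preadditive D]

/-! ### Finitely presented functors on a small preadditive category -/

/-- The cokernel of the map `(f, -) : (B, -) ⟶ (A, -)` between representable functors to abelian
groups. -/
def presented {A B : D} (f : A ⟶ B) : D ⥤ AddCommGrpCat.{u} :=
  cokernel (preadditiveCoyoneda.map f.op)

/-- A functor `F : D ⥤ Ab` is finitely presented if there is an exact sequence
`(B, -) ⟶ (A, -) ⟶ F ⟶ 0`. (For `D` with finite direct sums this is the usual notion; such a functor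
is automatically additive.) -/
def IsFP (D : Type u) [SmallCategory D] [Preadditive D] :
    ObjectProperty (D ⥤ AddCommGrpCat.{u}) := fun F =>
  ∃ (A B : D) (f : A ⟶ B), Nonempty (F ≅ presented f)

/-- Elementwise form of a finite presentation, used only to prove closure properties. -/
structure Pres (F : D ⥤ AddCommGrpCat.{u}) where
  A : D
  B : D
  f : A ⟶ B
  a : F.obj A
  gen : ∀ {X : D} (x : F.obj X), ∃ g : A ⟶ X, F.map g a = x
  rel : ∀ {X : D} (g : A ⟶ X), F.map g a = 0 ↔ ∃ z : B ⟶ X, f ≫ z = g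

lemma IsFP.additive_and_pres {F : D ⥤ AddCommGrpCat.{u}} (h : IsFP D F) :
    F.Additive ∧ Nonempty (Pres F) := by
  obtain ⟨A, B, f, ⟨e⟩⟩ := h
  let φ : preadditiveCoyoneda.obj (op B) ⟶ preadditiveCoyoneda.obj (op A) :=
    preadditiveCoyoneda.map f.op
  let e' : F ≅ cokernel φ := e
  let p : preadditiveCoyoneda.obj (op A) ⟶ F := cokernel.π φ ≫ e'.inv
  have hp : Epi p := epi_comp _ _
  have hs : ∀ X, Function.Surjective (p.app X) := fun X =>
    (AddCommGrpCat.epi_iff_surjective _).1 inferInstance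
  have w : φ ≫ p = 0 := by simp [p]
  let S : ShortComplex (D ⥤ AddCommGrpCat.{u}) := ShortComplex.mk φ p w
  have hS : S.Exact := by
    apply ShortComplex.exact_of_g_is_cokernel
    exact IsColimit.ofIsoColimit (cokernelIsCokernel φ) (Cofork.ext e'.symm rfl)
  have hSX : ∀ X, (S.map ((evaluation D AddCommGrpCat.{u}).obj X)).Exact := fun X => hS.map _
  have nat : ∀ {X Y : D} (y : A ⟶ X) (t : X ⟶ Y), F.map t (p.app X y) = p.app Y (y ≫ t) :=
    fun y t => (ConcreteCategory.congr_hom (p.naturality t) y).symm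
  have key : ∀ {X : D} (g : A ⟶ X), F.map g (p.app A (𝟙 A)) = p.app X g := fun g =>
    (nat (𝟙 A) g).trans (congrArg _ (Category.id_comp g))
  refine ⟨⟨?_⟩, ⟨⟨A, B, f, p.app A (𝟙 A), ?_, ?_⟩⟩⟩
  · intro X Y g g'
    ext x
    obtain ⟨y, rfl⟩ := hs X x
    refine (nat (y : A ⟶ X) (g + g')).trans ?_
    refine (congrArg _ (Preadditive.comp_add _ _ _ (y : A ⟶ X) g g')).trans ?_
    refine (map_add (p.app Y).hom ((y : A ⟶ X) ≫ g) ((y : A ⟶ X) ≫ g')).trans ?_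
    exact congrArg₂ (· + ·) (nat (y : A ⟶ X) g).symm (nat (y : A ⟶ X) g').symm
  · intro X x
    obtain ⟨g, rfl⟩ := hs X x
    exact ⟨g, key g⟩
  · intro X g
    rw [key]
    constructor
    · intro h0
      obtain ⟨z, hz⟩ := (ShortComplex.ab_exact_iff _).1 (hSX X) g h0
      exact ⟨z, hz⟩
    · rintro ⟨z, rfl⟩
      exact ConcreteCategory.congr_hom (congr_app w X) z

lemma Pres.isFP {F : D ⥤ AddCommGrpCat.{u}} [F.Additive] (P : Pres F) : IsFP D F := by
  let φ : preadditiveCoyoneda.obj (op P.B) ⟶ preadditiveCoyoneda.obj (op P.A) :=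
    preadditiveCoyoneda.map P.f.op
  let p : preadditiveCoyoneda.obj (op P.A) ⟶ F :=
    { app X := AddCommGrpCat.ofHom
        { toFun := fun g : P.A ⟶ X => F.map g P.a
          map_zero' := (P.rel (0 : P.A ⟶ X)).2 ⟨0, comp_zero⟩
          map_add' := fun g g' =>
            ConcreteCategory.congr_hom (F.map_add (f := (g : P.A ⟶ X)) (g := g')) P.a }
      naturality X Y g := by
        ext (x : P.A ⟶ X)
        exact ConcreteCategory.congr_hom (F.map_comp x g) P.a }
  have w : φ ≫ p = 0 := by
    ext X (z : P.B ⟶ X)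
    exact (P.rel (P.f ≫ z)).2 ⟨z, rfl⟩
  let d : presented P.f ⟶ F := cokernel.desc φ p w
  have hd : cokernel.π φ ≫ d = p := cokernel.π_desc _ _ _
  have hd' : ∀ X x, d.app X ((cokernel.π φ).app X x) = p.app X x := fun X x =>
    ConcreteCategory.congr_hom (congr_app hd X) x
  have : ∀ X, IsIso (d.app X) := fun X => by
    rw [ConcreteCategory.isIso_iff_bijective]
    constructor
    · rw [injective_iff_map_eq_zero]
      intro y hy
      obtain ⟨g, rfl⟩ := (AddCommGrpCat.epi_iff_surjective ((cokernel.π φ).app X)).1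
        inferInstance y
      rw [hd'] at hy
      obtain ⟨z, hz⟩ := (P.rel (g : P.A ⟶ X)).1 hy
      have := ConcreteCategory.congr_hom (congr_app (cokernel.condition φ) X) z
      refine Eq.trans ?_ this
      exact congrArg ((cokernel.π φ).app X) hz.symm
    · intro x
      obtain ⟨g, hg⟩ := P.gen x
      exact ⟨(cokernel.π φ).app X g, (hd' X g).trans hg⟩
  have : IsIso d := NatIso.isIso_of_isIso_app d
  exact ⟨P.A, P.B, P.f, ⟨(asIso d).symm⟩⟩

lemma nat_apply {F G : D ⥤ AddCommGrpCat.{u}} (α : F ⟶ G) {X Y : D} (g : X ⟶ Y) (x : F.obj X) :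
    G.map g (α.app X x) = α.app Y (F.map g x) :=
  (ConcreteCategory.congr_hom (α.naturality g) x).symm

lemma map_comp_apply' (F : D ⥤ AddCommGrpCat.{u}) {X Y Z : D} (g : X ⟶ Y) (h : Y ⟶ Z)
    (x : F.obj X) : F.map (g ≫ h) x = F.map h (F.map g x) :=
  ConcreteCategory.congr_hom (F.map_comp g h) x

lemma map_add_apply' (F : D ⥤ AddCommGrpCat.{u}) [F.Additive] {X Y : D} (g h : X ⟶ Y)
    (x : F.obj X) : F.map (g + h) x = F.map g x + F.map h x :=
  ConcreteCategory.congr_hom F.map_add x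

instance : (IsFP D).IsClosedUnderIsomorphisms where
  of_iso := by
    rintro F G e ⟨A, B, f, ⟨i⟩⟩
    exact ⟨A, B, f, ⟨e.symm ≪≫ i⟩⟩

instance [HasZeroObject D] : (IsFP D).ContainsZero where
  exists_zero := by
    open ZeroObject in
    have h0 : IsZero (AddCommGrpCat.of PUnit.{u + 1}) := AddCommGrpCat.isZero_of_subsingleton _
    refine ⟨(Functor.const D).obj (AddCommGrpCat.of PUnit.{u + 1}),
      Functor.isZero _ fun _ => h0, ?_⟩
    have : ((Functor.const D).obj (AddCommGrpCat.of PUnit.{u + 1})).Additive :=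
      ⟨h0.eq_of_src _ _⟩
    exact Pres.isFP ⟨0, 0, 𝟙 0, PUnit.unit, fun _ => ⟨0, rfl⟩,
      fun g => ⟨fun _ => ⟨g, Category.id_comp g⟩, fun _ => rfl⟩⟩

instance [HasBinaryBiproducts D] : (IsFP D).IsClosedUnderCokernels where
  cokernels_le := by
    rintro _ ⟨β, c, hc, hF, hG⟩
    rename_i F G
    obtain ⟨_, ⟨P⟩⟩ := hF.additive_and_pres
    obtain ⟨_, ⟨Q⟩⟩ := hG.additive_and_pres
    let p : G ⟶ c.pt := c.π
    have hp : Epi p := Cofork.IsColimit.epi hc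
    have w : β ≫ p = 0 := c.condition
    have hs : ∀ X, Function.Surjective (p.app X) := fun X =>
      (AddCommGrpCat.epi_iff_surjective _).1 inferInstance
    let S : ShortComplex (D ⥤ AddCommGrpCat.{u}) := ShortComplex.mk β p w
    have hS : S.Exact := by
      apply ShortComplex.exact_of_g_is_cokernel
      exact IsColimit.ofIsoColimit hc (Cofork.ext (Iso.refl _) (by simp [S, p]))
    have ex : ∀ X (y : G.obj X), p.app X y = 0 → ∃ x, β.app X x = y := fun X =>
      (ShortComplex.ab_exact_iff _).1 (hS.map ((evaluation D AddCommGrpCat.{u}).obj X))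
    have pw : ∀ X x, p.app X (β.app X x) = 0 := fun X x =>
      ConcreteCategory.congr_hom (congr_app w X) x
    have : c.pt.Additive := by
      refine ⟨fun {X Y g g'} => ?_⟩
      ext x
      obtain ⟨y, rfl⟩ := hs X x
      rw [nat_apply, map_add_apply', map_add, ← nat_apply, ← nat_apply]
      rfl
    obtain ⟨h, hh⟩ := Q.gen (β.app _ P.a)
    refine Pres.isFP ⟨Q.A, P.A ⊞ Q.B, biprod.lift h Q.f, p.app _ Q.a, ?_, ?_⟩
    · intro X x
      obtain ⟨y, rfl⟩ := hs X x
      obtain ⟨g, rfl⟩ := Q.gen y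
      exact ⟨g, nat_apply _ _ _⟩
    · intro X x
      rw [nat_apply]
      constructor
      · intro h0
        obtain ⟨t, ht⟩ := ex _ _ h0
        obtain ⟨g, rfl⟩ := P.gen t
        rw [← nat_apply, ← hh, ← map_comp_apply'] at ht
        have : G.map (x - h ≫ g) Q.a = 0 := by
          have := map_add_apply' G (x - h ≫ g) (h ≫ g) Q.a
          rw [sub_add_cancel, ht] at this
          simpa using this
        obtain ⟨z, hz⟩ := (Q.rel _).1 this
        exact ⟨biprod.desc g z, by rw [biprod.lift_desc, hz]; abel⟩
      · rintro ⟨z, rfl⟩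
        obtain ⟨g, k, rfl⟩ : ∃ g k, z = biprod.desc g k :=
          ⟨biprod.inl ≫ z, biprod.inr ≫ z, by ext <;> simp⟩
        rw [biprod.lift_desc, map_add_apply', (Q.rel (Q.f ≫ k)).2 ⟨k, rfl⟩, add_zero,
          map_comp_apply', hh, nat_apply, pw]

instance [HasPushouts D] : (IsFP D).IsClosedUnderKernels where
  kernels_le := by
    rintro _ ⟨α, c, hc, hF, hG⟩
    rename_i F G
    obtain ⟨_, ⟨P⟩⟩ := hF.additive_and_pres
    obtain ⟨_, ⟨Q⟩⟩ := hG.additive_and_pres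
    let k : c.pt ⟶ F := c.ι
    have hk : Mono k := Fork.IsLimit.mono hc
    have w : k ≫ α = 0 := c.condition
    have hi : ∀ X, Function.Injective (k.app X) := fun X =>
      (AddCommGrpCat.mono_iff_injective _).1 inferInstance
    let S : ShortComplex (D ⥤ AddCommGrpCat.{u}) := ShortComplex.mk k α w
    have hS : S.Exact := by
      apply ShortComplex.exact_of_f_is_kernel
      exact IsLimit.ofIsoLimit hc (Fork.ext (Iso.refl _) (by simp [S, k]))
    have ex : ∀ X (y : F.obj X), α.app X y = 0 → ∃ x, k.app X x = y := fun X =>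
      (ShortComplex.ab_exact_iff _).1 (hS.map ((evaluation D AddCommGrpCat.{u}).obj X))
    have kw : ∀ X x, α.app X (k.app X x) = 0 := fun X x =>
      ConcreteCategory.congr_hom (congr_app w X) x
    have : c.pt.Additive := by
      refine ⟨fun {X Y g g'} => ?_⟩
      ext x
      apply hi Y
      rw [← nat_apply, map_add_apply', nat_apply, nat_apply, ← map_add]
      rfl
    obtain ⟨h, hh⟩ := Q.gen (α.app _ P.a)
    have hα : ∀ {X : D} (x : P.A ⟶ X),
        α.app X (F.map x P.a) = 0 ↔ ∃ y : Q.B ⟶ X, Q.f ≫ y = h ≫ x := fun {X} x => by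
      rw [← nat_apply, ← hh, ← map_comp_apply', Q.rel]
    let i : P.A ⟶ pushout Q.f h := pushout.inr _ _
    obtain ⟨q, hq⟩ := ex _ (F.map i P.a) ((hα i).2 ⟨pushout.inl _ _, pushout.condition⟩)
    have hqu : ∀ {X : D} (u : pushout Q.f h ⟶ X), k.app X (c.pt.map u q) = F.map (i ≫ u) P.a :=
      fun u => by rw [← nat_apply, hq, map_comp_apply']
    refine Pres.isFP ⟨pushout Q.f h, pushout i P.f, pushout.inl _ _, q, ?_, ?_⟩
    · intro X x
      obtain ⟨g, hg⟩ := P.gen (k.app X x)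
      obtain ⟨y, hy⟩ := (hα g).1 (by rw [hg, kw])
      refine ⟨pushout.desc y g hy, hi X ?_⟩
      rw [hqu, ← hg]
      exact congrArg (fun t => F.map t P.a) (pushout.inr_desc _ _ _)
    · intro X u
      have : c.pt.map u q = 0 ↔ F.map (i ≫ u) P.a = 0 := by
        rw [← hqu, map_eq_zero_iff _ (hi X)]
      rw [this, P.rel]
      constructor
      · rintro ⟨z, hz⟩
        exact ⟨pushout.desc u z hz.symm, pushout.inl_desc _ _ _⟩
      · rintro ⟨z, rfl⟩
        exact ⟨pushout.inr _ _ ≫ z, by rw [← pushout.condition_assoc]⟩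

lemma biprod_add {F G : D ⥤ AddCommGrpCat.{u}} {X : D} (x : (F ⊞ G : D ⥤ AddCommGrpCat.{u}).obj X) :
    (biprod.inl : F ⟶ F ⊞ G).app X ((biprod.fst : F ⊞ G ⟶ F).app X x) +
      (biprod.inr : G ⟶ F ⊞ G).app X ((biprod.snd : F ⊞ G ⟶ G).app X x) = x :=
  ConcreteCategory.congr_hom (congr_app (biprod.total (X := F) (Y := G)) X) x

lemma biprod_ext {F G : D ⥤ AddCommGrpCat.{u}} {X : D}
    {x y : (F ⊞ G : D ⥤ AddCommGrpCat.{u}).obj X}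
    (h₁ : (biprod.fst : F ⊞ G ⟶ F).app X x = (biprod.fst : F ⊞ G ⟶ F).app X y)
    (h₂ : (biprod.snd : F ⊞ G ⟶ G).app X x = (biprod.snd : F ⊞ G ⟶ G).app X y) : x = y := by
  rw [← biprod_add x, ← biprod_add y, h₁, h₂]

lemma isFP_biprod [HasBinaryBiproducts D] {F G : D ⥤ AddCommGrpCat.{u}} (hF : IsFP D F)
    (hG : IsFP D G) : IsFP D (F ⊞ G) := by
  obtain ⟨_, ⟨P⟩⟩ := hF.additive_and_pres
  obtain ⟨_, ⟨Q⟩⟩ := hG.additive_and_pres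
  have : (F ⊞ G : D ⥤ AddCommGrpCat.{u}).Additive := by
    refine ⟨fun {X Y g g'} => ?_⟩
    ext x
    change _ = (F ⊞ G).map g x + (F ⊞ G).map g' x
    apply biprod_ext <;> rw [← nat_apply, map_add_apply', nat_apply, nat_apply, ← map_add]
  let a : (F ⊞ G : D ⥤ AddCommGrpCat.{u}).obj (P.A ⊞ Q.A) :=
    (biprod.inl : F ⟶ F ⊞ G).app _ (F.map biprod.inl P.a) +
      (biprod.inr : G ⟶ F ⊞ G).app _ (G.map biprod.inr Q.a)
  have h1 : (biprod.fst : F ⊞ G ⟶ F).app _ a = F.map biprod.inl P.a := by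
    have e1 := ConcreteCategory.congr_hom (congr_app (biprod.inl_fst (X := F) (Y := G))
      (P.A ⊞ Q.A)) (F.map biprod.inl P.a)
    have e2 := ConcreteCategory.congr_hom (congr_app (biprod.inr_fst (X := F) (Y := G))
      (P.A ⊞ Q.A)) (G.map biprod.inr Q.a)
    exact (map_add _ _ _).trans ((congrArg₂ (· + ·) e1 e2).trans (add_zero _))
  have h2 : (biprod.snd : F ⊞ G ⟶ G).app _ a = G.map biprod.inr Q.a := by
    have e1 := ConcreteCategory.congr_hom (congr_app (biprod.inl_snd (X := F) (Y := G))
      (P.A ⊞ Q.A)) (F.map biprod.inl P.a)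
    have e2 := ConcreteCategory.congr_hom (congr_app (biprod.inr_snd (X := F) (Y := G))
      (P.A ⊞ Q.A)) (G.map biprod.inr Q.a)
    exact (map_add _ _ _).trans ((congrArg₂ (· + ·) e1 e2).trans (zero_add _))
  have k1 : ∀ {X : D} (g : P.A ⊞ Q.A ⟶ X), (biprod.fst : F ⊞ G ⟶ F).app X ((F ⊞ G).map g a) =
      F.map (biprod.inl ≫ g) P.a := fun g => by rw [← nat_apply, h1, map_comp_apply']
  have k2 : ∀ {X : D} (g : P.A ⊞ Q.A ⟶ X), (biprod.snd : F ⊞ G ⟶ G).app X ((F ⊞ G).map g a) =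
      G.map (biprod.inr ≫ g) Q.a := fun g => by rw [← nat_apply, h2, map_comp_apply']
  refine Pres.isFP ⟨P.A ⊞ Q.A, P.B ⊞ Q.B, biprod.map P.f Q.f, a, ?_, ?_⟩
  · intro X x
    obtain ⟨g, hg⟩ := P.gen ((biprod.fst : F ⊞ G ⟶ F).app X x)
    obtain ⟨g', hg'⟩ := Q.gen ((biprod.snd : F ⊞ G ⟶ G).app X x)
    refine ⟨biprod.desc g g', biprod_ext ?_ ?_⟩
    · rw [k1, ← hg, biprod.inl_desc]
    · rw [k2, ← hg', biprod.inr_desc]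
  · intro X g
    have : (F ⊞ G).map g a = 0 ↔
        F.map (biprod.inl ≫ g) P.a = 0 ∧ G.map (biprod.inr ≫ g) Q.a = 0 := by
      rw [← k1, ← k2]
      constructor
      · intro h
        rw [h]
        exact ⟨map_zero _, map_zero _⟩
      · rintro ⟨e1, e2⟩
        exact biprod_ext (e1.trans (map_zero _).symm) (e2.trans (map_zero _).symm)
    rw [this, P.rel, Q.rel]
    constructor
    · rintro ⟨⟨z, hz⟩, ⟨z', hz'⟩⟩
      exact ⟨biprod.desc z z', by ext <;> simp [hz, hz']⟩
    · rintro ⟨z, rfl⟩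
      exact ⟨⟨biprod.inl ≫ z, by simp⟩, ⟨biprod.inr ≫ z, by simp⟩⟩

instance [HasZeroObject D] [HasBinaryBiproducts D] : (IsFP D).IsClosedUnderFiniteProducts := by
  have : (IsFP D).IsClosedUnderBinaryProducts := by
    refine .mk' ?_
    rintro _ ⟨K, hK⟩
    refine (IsFP D).prop_of_iso ?_ (isFP_biprod (hK ⟨.left⟩) (hK ⟨.right⟩))
    exact (biprod.isoProd _ _) ≪≫ (HasLimit.isoOfNatIso (diagramIsoPair K)).symm
  exact ObjectProperty.IsClosedUnderFiniteProducts.mk'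

end

section
variable (D : Type u) [SmallCategory D] [Preadditive D]

/-! ### The category of finitely presented functors -/

/-- The category `(D, Ab)^fp` of finitely presented functors `D ⥤ Ab` and all natural
transformations between them. To have a small category, an object is a presentation, that is, a
morphism `f : A ⟶ B` of `D`, and it stands for the functor `coker ((f, -) : (B, -) ⟶ (A, -))`;
see `FP.toFull` for the equivalence with the full subcategory of functors. -/
def FP : Type u := InducedCategory (D ⥤ AddCommGrpCat.{u}) fun a : Arrow D => presented a.hom

instance : SmallCategory (FP D) :=
  inferInstanceAs (Category (InducedCategory _ fun a : Arrow D => presented a.hom))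

instance : Preadditive (FP D) :=
  inferInstanceAs (Preadditive (InducedCategory _ fun a : Arrow D => presented a.hom))

/-- The fully faithful functor that sends an object of `FP D` to the functor it presents. -/
def FP.ι : FP D ⥤ D ⥤ AddCommGrpCat.{u} := inducedFunctor fun a : Arrow D => presented a.hom

instance : (FP.ι D).Full := InducedCategory.full _
instance : (FP.ι D).Faithful := InducedCategory.faithful _
instance : (FP.ι D).Additive := inferInstanceAs (inducedFunctor _).Additive

lemma FP.ι_prop (X : FP D) : IsFP D ((FP.ι D).obj X) := ⟨_, _, (show Arrow D from X).hom, ⟨Iso.refl _⟩⟩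

/-- `FP D` is equivalent to the full subcategory of finitely presented functors. -/
def FP.toFull : FP D ⥤ (IsFP D).FullSubcategory := (IsFP D).lift (FP.ι D) (FP.ι_prop D)

instance : (FP.toFull D).Full := inferInstanceAs (ObjectProperty.lift _ _ _).Full
instance : (FP.toFull D).Faithful := inferInstanceAs (ObjectProperty.lift _ _ _).Faithful
instance : (FP.toFull D).EssSurj where
  mem_essImage := by
    rintro ⟨F, A, B, f, ⟨e⟩⟩
    exact ⟨Arrow.mk f, ⟨(IsFP D).isoMk e.symm⟩⟩
instance : (FP.toFull D).IsEquivalence where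
instance : (FP.toFull D).Additive where

variable [HasZeroObject D] [HasBinaryBiproducts D]

instance : HasFiniteProducts (FP D) where
  out _ := Adjunction.hasLimitsOfShape_of_equivalence (FP.toFull D)

instance : HasFiniteBiproducts (FP D) := HasFiniteBiproducts.of_hasFiniteProducts
instance : HasBinaryBiproducts (FP D) := hasBinaryBiproducts_of_finite_biproducts _
instance : HasZeroObject (FP D) := hasZeroObject_of_hasFiniteBiproducts _

instance : HasFiniteColimits (FP D) := by
  have : HasFiniteBiproducts (IsFP D).FullSubcategory := HasFiniteBiproducts.of_hasFiniteProducts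
  have : HasCoequalizers (IsFP D).FullSubcategory := Preadditive.hasCoequalizers_of_hasCokernels
  have : HasCoequalizers (FP D) := Adjunction.hasColimitsOfShape_of_equivalence (FP.toFull D)
  exact hasFiniteColimits_of_hasCoequalizers_and_finite_coproducts

instance : PreservesFiniteColimits (FP.ι D) := by
  have : HasFiniteBiproducts (IsFP D).FullSubcategory := HasFiniteBiproducts.of_hasFiniteProducts
  have : HasCoequalizers (IsFP D).FullSubcategory := Preadditive.hasCoequalizers_of_hasCokernels
  have : PreservesFiniteColimits (IsFP D).ι := by
    have : HasBinaryBiproducts (IsFP D).FullSubcategory :=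
      hasBinaryBiproducts_of_finite_biproducts _
    have := fun {X Y : (IsFP D).FullSubcategory} (f : X ⟶ Y) => (IsFP D).preservesCokernels_ι f
    exact Functor.preservesFiniteColimits_of_preservesCokernels _
  exact inferInstanceAs (PreservesFiniteColimits (FP.toFull D ⋙ (IsFP D).ι))

variable [HasPushouts D]

/-- If `D` is additive with pushouts (equivalently, with cokernels), `(D, Ab)^fp` is abelian. -/
instance : Abelian (FP D) := abelianOfEquivalence (FP.toFull D)

instance : PreservesFiniteLimits (FP.ι D) := by
  have : HasFiniteBiproducts (IsFP D).FullSubcategory := HasFiniteBiproducts.of_hasFiniteProducts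
  have : PreservesFiniteLimits (IsFP D).ι := by
    have : HasBinaryBiproducts (IsFP D).FullSubcategory :=
      hasBinaryBiproducts_of_finite_biproducts _
    have := fun {X Y : (IsFP D).FullSubcategory} (f : X ⟶ Y) => (IsFP D).preservesKernels_ι f
    exact Functor.preservesFiniteLimits_of_preservesKernels _
  exact inferInstanceAs (PreservesFiniteLimits (FP.toFull D ⋙ (IsFP D).ι))

end

section

/-! ### Modules over a skeletally small preadditive category, and the free abelian category -/

variable (R : Type w) [Category.{u} R] [Preadditive R] [EssentiallySmall.{u} R]

/-- A finite family of objects of (a small model of) `R`, as an object of Mathlib's additive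
completion `Mat_ R`. -/
def matOf (a : Σ n : ℕ, Fin n → SmallModel.{u} R) : Mat_ R :=
  ⟨Fin a.1, fun i => (equivSmallModel R).inverse.obj (a.2 i)⟩

/-- A small model of the additive completion of the skeletally small preadditive category `R`:
objects are finite families of objects of `R`, morphisms are matrices of morphisms of `R`. -/
def AddClosure : Type u := InducedCategory (Mat_ R) (matOf R)

instance : SmallCategory (AddClosure R) :=
  inferInstanceAs (Category (InducedCategory _ (matOf R)))

instance : Preadditive (AddClosure R) :=
  inferInstanceAs (Preadditive (InducedCategory _ (matOf R)))

/-- `AddClosure R` is equivalent to Mathlib's additive completion `Mat_ R`. -/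
def AddClosure.toMat : AddClosure R ⥤ Mat_ R := inducedFunctor (matOf R)

instance : (AddClosure.toMat R).Full := InducedCategory.full _
instance : (AddClosure.toMat R).Faithful := InducedCategory.faithful _
instance : (AddClosure.toMat R).Additive := inferInstanceAs (inducedFunctor _).Additive

variable {R} in
lemma matIso {M N : Mat_ R} (e : M.ι ≃ N.ι) (i : ∀ j, N.X (e j) ≅ M.X j) : Nonempty (M ≅ N) :=
  ⟨M.isoBiproductEmbedding ≪≫
    biproduct.whiskerEquiv e (fun j => (Mat_.embedding R).mapIso (i j)) ≪≫
    N.isoBiproductEmbedding.symm⟩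

instance : (AddClosure.toMat R).EssSurj where
  mem_essImage M := by
    let e := Fintype.equivFin M.ι
    let a : Σ n : ℕ, Fin n → SmallModel.{u} R :=
      ⟨Fintype.card M.ι, fun i => (equivSmallModel R).functor.obj (M.X (e.symm i))⟩
    exact ⟨a, matIso (M := matOf R a) e.symm
      fun i => (equivSmallModel R).unitIso.app (M.X (e.symm i))⟩
instance : (AddClosure.toMat R).IsEquivalence where

instance : HasFiniteProducts (AddClosure R) where
  out _ := Adjunction.hasLimitsOfShape_of_equivalence (AddClosure.toMat R)
instance : HasFiniteBiproducts (AddClosure R) := HasFiniteBiproducts.of_hasFiniteProducts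
instance : HasBinaryBiproducts (AddClosure R) := hasBinaryBiproducts_of_finite_biproducts _

/-- The category `R-mod` of finitely presented (left) `R`-modules. An `R`-module is the same thing as
an additive functor on the additive completion of `R`, and it is finitely presented if and only if it
is the cokernel of a map between finite direct sums of representable functors. -/
abbrev FpMod : Type u := FP (AddClosure R)

/-- The free abelian category `Ab(R) = (R-mod, Ab)^fp` on `R`. -/
abbrev FreeAb : Type u := FP (FpMod R)

variable {R} (M : R ⥤ AddCommGrpCat.{u}) [M.Additive]

/-- The extension of an `R`-module `M` (an additive functor `M : R ⥤ Ab`) to the additive completion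
of `R`: a family `(p i)` goes to the direct sum of the `M (p i)`. -/
def extMod : AddClosure R ⥤ AddCommGrpCat.{u} where
  obj X := ⨁ fun i => M.obj (((AddClosure.toMat R).obj X).X i)
  map f := biproduct.matrix fun i j => M.map ((AddClosure.toMat R).map f i j)
  map_id X := by
    refine biproduct.hom_ext _ _ fun i => biproduct.hom_ext' _ _ fun j => ?_
    by_cases h : j = i
    · subst h; simp
    · simp [h]
  map_comp f g := by
    refine biproduct.hom_ext _ _ fun i => biproduct.hom_ext' _ _ fun j => ?_
    simp [biproduct.lift_desc]

instance : (extMod M).Additive where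
  map_add {X Y f g} := by
    refine biproduct.hom_ext _ _ fun i => biproduct.hom_ext' _ _ fun j => ?_
    simp only [extMod]
    erw [Preadditive.add_comp, Preadditive.comp_add]
    simp

/-- The filtered category of finitely presented modules `A` with a homomorphism `A ⟶ M`. -/
abbrev Approx : Type u := CostructuredArrow (FP.ι (AddClosure R)) (extMod M)

instance : IsFiltered (Approx M) :=
  have := coflat_of_preservesFiniteColimits (FP.ι (AddClosure R))
  inferInstance

/-- The extension `M~ : Ab(R) ⥤ Ab` of `M : R ⥤ Ab` to an exact functor. An object of `Ab(R)` is a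
functor `F` on finitely presented modules; its value at `M` is the value at `M` of the extension of `F`
to all modules that commutes with direct limits: the filtered colimit of the `F(A)` over all
`A ⟶ M` with `A` finitely presented. -/
def tilde : FreeAb R ⥤ AddCommGrpCat.{u} :=
  FP.ι (FpMod R) ⋙ (Functor.whiskeringLeft _ _ _).obj
    (CostructuredArrow.proj (FP.ι (AddClosure R)) (extMod M)) ⋙ colim

instance : PreservesFiniteLimits (tilde M) := by
  unfold tilde; infer_instance

instance : PreservesFiniteColimits (tilde M) := by
  unfold tilde; infer_instance

/-- The Serre subcategory `S_M = {F | M~ F = 0}` of `Ab(R)`. -/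
abbrev killed : ObjectProperty (FreeAb R) := (tilde M).kernel

/-- The quotient `A/P` of an abelian category by a Serre subcategory: the localization at the
morphisms with kernel and cokernel in `P`. -/
abbrev SerreQuotient {A : Type u} [SmallCategory A] [Abelian A] (P : ObjectProperty A)
    [P.IsSerreClass] : Type u := P.isoModSerre.Localization

instance {A : Type u} [SmallCategory A] [Abelian A] (P : ObjectProperty A)
    [P.IsSerreClass] : Abelian (SerreQuotient P) :=
  ObjectProperty.SerreClassLocalization.abelian P.isoModSerre.Q P

/-- The abelian category `A(M) = Ab(R)/S_M` associated to the module `M`. -/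
abbrev AssocCat : Type u := SerreQuotient (killed M)

lemma killed_inverted : (killed M).isoModSerre.IsInvertedBy (tilde M) := by
  intro X Y f hf
  rwa [Abelian.isoModSerre_kernel_eq_inverseImage_isomorphisms] at hf

/-- The exact functor `M^ : A(M) ⥤ Ab` induced by `M~`. -/
def hat : AssocCat M ⥤ AddCommGrpCat.{u} :=
  Localization.lift (tilde M) (killed_inverted M) (killed M).isoModSerre.Q

end

/-! ### Modules over rings, and abelian generators -/

/-- A ring `S`, seen as a preadditive category with one object (additive functors `SingleObj S ⥤ Ab`
are left `S`-modules), is skeletally small. -/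
instance (S : Type u) [Ring S] : EssentiallySmall.{u} (SingleObj S) := essentiallySmallSelf.{u} _

section

variable {R : Type w} [Category.{u} R] [Preadditive R] [EssentiallySmall.{u} R]
  {R' : Type v} [Category.{u} R'] [Preadditive R'] [EssentiallySmall.{u} R']

/-- Two modules, possibly over different preadditive categories, are the same module if there is an
equivalence between their associated abelian categories that carries one exact functor to the
other. -/
def SameModule (M : R ⥤ AddCommGrpCat.{u}) [M.Additive] (N : R' ⥤ AddCommGrpCat.{u})
    [N.Additive] : Prop :=
  ∃ H : AssocCat M ≌ AssocCat N, Nonempty (H.functor ⋙ hat N ≅ hat M)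

/-- The module `M` is over a ring: it can be represented by an additive functor from a preadditive
category with a single object, that is, by a module over a ring with `1`. -/
def IsOverRing (M : R ⥤ AddCommGrpCat.{u}) [M.Additive] : Prop :=
  ∃ (S : Type u) (_ : Ring S) (N : SingleObj S ⥤ AddCommGrpCat.{u}) (_ : N.Additive),
    SameModule M N

/-- The category `A(M)` is a quotient of `Ab(S)` by a Serre subcategory, for some ring `S`
with `1`. -/
def IsQuotientOverRing (M : R ⥤ AddCommGrpCat.{u}) [M.Additive] : Prop :=
  ∃ (S : Type u) (_ : Ring S) (P : ObjectProperty (FreeAb (SingleObj S))) (_ : P.IsSerreClass),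
    Nonempty (SerreQuotient P ≌ AssocCat M)

end

/-- A (possibly non-full) abelian subcategory of `A`, up to equivalence: an abelian category with a
faithful exact functor to `A`. (A subcategory that is abelian with exact inclusion is of this form,
and after replacing `A` by an equivalent category every faithful exact functor to `A` becomes the
inclusion of such a subcategory.) -/
structure AbelianSubcategory (A : Type w) [Category.{v} A] [Abelian A] where
  /-- the abelian category -/
  B : Type w
  [category : Category.{v} B]
  [abelian : Abelian B]
  /-- the inclusion functor -/
  incl : B ⥤ A
  [faithful : incl.Faithful]
  [preservesFiniteLimits : PreservesFiniteLimits incl]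
  [preservesFiniteColimits : PreservesFiniteColimits incl]

attribute [instance] AbelianSubcategory.category AbelianSubcategory.abelian
  AbelianSubcategory.faithful AbelianSubcategory.preservesFiniteLimits
  AbelianSubcategory.preservesFiniteColimits

/-- `U` is an abelian generator of the abelian category `A` if `A` is the smallest abelian
subcategory of `A` that contains `U` and all its endomorphisms: whenever an abelian subcategory
`I : B ⥤ A` contains `U` (as the image, up to an isomorphism `e`, of an object `V`) and all
endomorphisms of `U` (each is the image of an endomorphism of `V`), it contains all of `A`, that is,
the identity functor of `A` factors through `I`, compatibly with the inclusions of `U` in `A` and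
in `B`. -/
def IsAbelianGenerator {A : Type w} [Category.{v} A] [Abelian A] (U : A) : Prop :=
  ∀ (I : AbelianSubcategory A) (V : I.B) (e : I.incl.obj V ≅ U),
    (∀ f : U ⟶ U, ∃ g : V ⟶ V, I.incl.map g = e.hom ≫ f ≫ e.inv) →
    ∃ (s : A ⥤ I.B) (η : s ⋙ I.incl ≅ 𝟭 A) (σ : s.obj U ≅ V),
      I.incl.map σ.hom ≫ e.hom = η.hom.app U

end ModExact

end

/-! The engine is the universal property of the free abelian category: an additive functor from `R`
to an abelian category extends to an exact functor on `FreeAb R` (`FreeAb.exists_extension`), and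
exact functors that agree on `R` are isomorphic (`FreeAb.nonempty_iso`). For a ring `S`, an exact
functor out of `FreeAb (SingleObj S)` is therefore the same datum, up to isomorphism, as an object
with an action of `S`.

Suppose that `A` is a Serre quotient of the free abelian category on `S`, and let `U` be the image
of the single object. If `I : B ⥤ A` is an abelian subcategory containing `U` and its endomorphisms,
the action of `S` on `U` lifts to `B` and extends to an exact functor `G` into `B`. By uniqueness `G
⋙ I` is the quotient functor. As `I` reflects isomorphisms, `G` factors through the quotient, and
this factorization is the required section of `I` (`isAbelianGenerator_of_isLocalization`).

Conversely, let `U` be an abelian generator of `A(M)`, put `S = End U`, and let `N` be the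
`S`-module `hat M` of `U`. The exact functor from the free abelian category on `S` to `A(M)` given
by `U` kills exactly what `tilde N` kills, because `hat M` is faithful. It thus induces a faithful
exact functor `J` from `A(N)` to `A(M)` whose image contains `U` and its endomorphisms. The
generator property gives a section of `J`, and uniqueness of extensions makes it a quasi-inverse
(`isOverRing_of_isAbelianGenerator`). Since `A(N)` is itself a Serre quotient, the three conditions
imply each other in a cycle.

The universal property comes from two applications of the free completion under cokernels
(`IsFreyd`, `FP.isFreyd_yo`), to the opposite of the additive completion of `R` and then to the
opposite of `R-mod`. The second extension is exact, not just right exact, because it extends a left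
exact functor (`IsFreyd.preservesFiniteLimits`). -/

noncomputable section

namespace ModExact

/-! ### Free completion of a preadditive category under cokernels. -/

section Freyd

universe v₁ v₂ v₃ u₁ u₂ u₃

variable {P : Type u₁} [Category.{v₁} P] [Preadditive P]
  {E : Type u₂} [Category.{v₂} E] [Preadditive E]

/-- A presentation of `X` as the cokernel of a morphism in the image of `y`. -/
structure CokerPres (y : P ⥤ E) (X : E) where
  A : P
  B : P
  f : B ⟶ A
  p : y.obj A ⟶ X
  w : y.map f ≫ p = 0
  isColimit : IsColimit (CokernelCofork.ofπ p w)

/-- The functor `y` exhibits `E` as the free completion of the preadditive category `P` under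
cokernels. -/
structure IsFreyd (y : P ⥤ E) : Prop where
  full : y.Full
  faithful : y.Faithful
  additive : y.Additive
  lift {X Y Z : E} (a : X ⟶ Y) (c : Y ⟶ Z) (w : a ≫ c = 0)
    (h : IsColimit (CokernelCofork.ofπ c w)) {A : P} (q : y.obj A ⟶ Z) : ∃ q', q' ≫ c = q
  exact {X Y Z : E} (a : X ⟶ Y) (c : Y ⟶ Z) (w : a ≫ c = 0)
    (h : IsColimit (CokernelCofork.ofπ c w)) {A : P} (q : y.obj A ⟶ Y) (hq : q ≫ c = 0) :
    ∃ q', q' ≫ a = q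
  pres (X : E) : Nonempty (CokerPres y X)

omit [Preadditive P] in
lemma CokerPres.hom_ext {y : P ⥤ E} {X Z : E} (R : CokerPres y X) {g h : X ⟶ Z}
    (e : R.p ≫ g = R.p ≫ h) : g = h :=
  Cofork.IsColimit.hom_ext R.isColimit e

variable {B : Type u₃} [Category.{v₃} B]

namespace IsFreyd

variable {y : P ⥤ E} (hy : IsFreyd y)

include hy

/-- `T` sends the presentation map `y A ⟶ X` to an epimorphism, so naturality determines the
component at `X`. -/
lemma hom_ext_of_preserves [HasZeroMorphisms B] {T T' : E ⥤ B} [T.PreservesZeroMorphisms]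
    [∀ {X Y : E} (f : X ⟶ Y), PreservesColimit (parallelPair f 0) T]
    {φ ψ : T ⟶ T'} (h : ∀ A, φ.app (y.obj A) = ψ.app (y.obj A)) : φ = ψ := by
  ext X
  obtain ⟨R⟩ := hy.pres X
  refine Cofork.IsColimit.hom_ext (CokernelCofork.mapIsColimit _ R.isColimit T) ?_
  change T.map R.p ≫ _ = T.map R.p ≫ _
  rw [φ.naturality, ψ.naturality, h]

/-- The component at `X` is induced out of the cokernel `T X` along a chosen presentation. Any `q :
y A ⟶ X` lifts through that presentation, which gives `key`; naturality and the values on `y A`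
follow from it. -/
lemma exists_natTrans [HasZeroMorphisms B] {T T' : E ⥤ B} [T.PreservesZeroMorphisms]
    [T'.PreservesZeroMorphisms]
    [∀ {X Y : E} (f : X ⟶ Y), PreservesColimit (parallelPair f 0) T]
    (φ : y ⋙ T ⟶ y ⋙ T') : ∃ ψ : T ⟶ T', ∀ A, ψ.app (y.obj A) = φ.app A := by
  let R := fun X => (hy.pres X).some
  have hR := fun X => CokernelCofork.mapIsColimit _ (R X).isColimit T
  have w : ∀ X, T.map (y.map (R X).f) ≫ φ.app (R X).A ≫ T'.map (R X).p = 0 := fun X => by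
    have h := φ.naturality (R X).f
    dsimp at h
    rw [reassoc_of% h, ← T'.map_comp, (R X).w, T'.map_zero, comp_zero]
  have ex : ∀ X, ∃ l : T.obj X ⟶ T'.obj X,
      T.map (R X).p ≫ l = φ.app (R X).A ≫ T'.map (R X).p := fun X =>
    ⟨_, (CokernelCofork.IsColimit.desc' (hR X) _ (w X)).2⟩
  choose l hl using ex
  have := hy.full
  have key : ∀ {A X} (q : y.obj A ⟶ X), T.map q ≫ l X = φ.app A ≫ T'.map q := by
    intro A X q
    obtain ⟨q', hq'⟩ := hy.lift _ _ _ (R X).isColimit q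
    obtain ⟨g, rfl⟩ := y.map_surjective q'
    have h := φ.naturality g
    dsimp at h
    rw [← hq', T.map_comp, Category.assoc, hl, reassoc_of% h, T'.map_comp]
  refine ⟨{ app := l, naturality := fun X Y α => ?_ }, fun A => ?_⟩
  · refine Cofork.IsColimit.hom_ext (hR X) ?_
    change T.map (R X).p ≫ T.map α ≫ l Y = T.map (R X).p ≫ l X ≫ T'.map α
    rw [← Category.assoc, ← T.map_comp, key, ← Category.assoc, key, T'.map_comp, Category.assoc]
  · simpa using key (𝟙 (y.obj A))

/-- Functors preserving cokernels which agree on the image of `y` are isomorphic. -/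
lemma nonempty_iso [HasZeroMorphisms B] {T T' : E ⥤ B} [T.PreservesZeroMorphisms]
    [T'.PreservesZeroMorphisms]
    [∀ {X Y : E} (f : X ⟶ Y), PreservesColimit (parallelPair f 0) T]
    [∀ {X Y : E} (f : X ⟶ Y), PreservesColimit (parallelPair f 0) T']
    (φ : y ⋙ T ≅ y ⋙ T') : Nonempty (T ≅ T') := by
  obtain ⟨ψ, hψ⟩ := hy.exists_natTrans φ.hom
  obtain ⟨ψ', hψ'⟩ := hy.exists_natTrans φ.inv
  refine ⟨⟨ψ, ψ', ?_, ?_⟩⟩ <;> refine hy.hom_ext_of_preserves fun A => ?_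
  · simp [hψ, hψ']
  · simp [hψ, hψ']

/-- Every additive functor `P ⥤ B` extends to a functor `E ⥤ B` preserving cokernels. -/
lemma exists_extension [HasCokernels E] [Preadditive B] [HasCokernels B] (F : P ⥤ B) [F.Additive] :
    ∃ (T : E ⥤ B) (_ : T.Additive), Nonempty (y ⋙ T ≅ F) ∧
      ∀ {X Y : E} (f : X ⟶ Y), PreservesColimit (parallelPair f 0) T := by
  have := hy.full
  have := hy.faithful
  have := hy.additive
  let R := fun X => (hy.pres X).some
  let O : E → B := fun X => cokernel (F.map (R X).f)
  have ex : ∀ {A X} (q : y.obj A ⟶ X), ∃ g : A ⟶ (R X).A, y.map g ≫ (R X).p = q := by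
    intro A X q
    obtain ⟨q', hq'⟩ := hy.lift _ _ _ (R X).isColimit q
    obtain ⟨g, rfl⟩ := y.map_surjective q'
    exact ⟨g, hq'⟩
  have zero : ∀ {A X} (g : A ⟶ (R X).A), y.map g ≫ (R X).p = 0 →
      F.map g ≫ cokernel.π (F.map (R X).f) = 0 := by
    intro A X g hg
    obtain ⟨q, hq⟩ := hy.exact _ _ _ (R X).isColimit _ hg
    obtain ⟨z, rfl⟩ := y.map_surjective q
    rw [← y.map_comp] at hq
    rw [← y.map_injective hq, F.map_comp, Category.assoc, cokernel.condition, comp_zero]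
  -- `ev q` plays the role of `T.map q` under the expected identification `T (y A) ≅ F A`. It is
  -- well defined: two lifts of `q` differ by a map that `(R X).p` kills, which `zero` handles.
  have exev : ∀ {A X} (q : y.obj A ⟶ X), ∃ e : F.obj A ⟶ O X, ∀ g : A ⟶ (R X).A,
      y.map g ≫ (R X).p = q → F.map g ≫ cokernel.π (F.map (R X).f) = e := by
    intro A X q
    obtain ⟨g, hg⟩ := ex q
    refine ⟨F.map g ≫ cokernel.π (F.map (R X).f), fun g' hg' => ?_⟩
    rw [← sub_eq_zero, ← Preadditive.sub_comp, ← F.map_sub]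
    apply zero
    rw [y.map_sub, Preadditive.sub_comp, hg, hg', sub_self]
  choose ev hev using @exev
  have ev_p : ∀ X, ev (R X).p = cokernel.π (F.map (R X).f) := fun X => by
    rw [← hev (R X).p (𝟙 _) (by simp)]; simp
  have ev_comp : ∀ {A A' X} (g : A' ⟶ A) (q : y.obj A ⟶ X),
      ev (y.map g ≫ q) = F.map g ≫ ev q := by
    intro A A' X g q
    obtain ⟨k, hk⟩ := ex q
    rw [← hev q k hk, ← hev _ (g ≫ k) (by simp [hk]), F.map_comp, Category.assoc]
  have ev_add : ∀ {A X} (q q' : y.obj A ⟶ X), ev (q + q') = ev q + ev q' := by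
    intro A X q q'
    obtain ⟨k, hk⟩ := ex q
    obtain ⟨k', hk'⟩ := ex q'
    rw [← hev q k hk, ← hev _ k' hk', ← hev _ (k + k') (by simp [hk, hk']), F.map_add,
      Preadditive.add_comp]
  have hom_ext : ∀ {X Z} (u v : O X ⟶ Z), (∀ A (q : y.obj A ⟶ X), ev q ≫ u = ev q ≫ v) → u = v := by
    intro X Z u v h
    have := h _ (R X).p
    rw [ev_p] at this
    exact (cancel_epi _).1 this
  -- `O X` is universal for additive families compatible with precomposition, indexed by all `q : y
  -- A ⟶ X`. Morphisms out of `O X` can thus be built without returning to the presentation.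
  have desc : ∀ {X Z} (v : ∀ {A}, (y.obj A ⟶ X) → (F.obj A ⟶ Z)),
      (∀ {A} (q q' : y.obj A ⟶ X), v (q + q') = v q + v q') →
      (∀ {A A'} (g : A' ⟶ A) (q : y.obj A ⟶ X), v (y.map g ≫ q) = F.map g ≫ v q) →
      ∃ u : O X ⟶ Z, ∀ {A} (q : y.obj A ⟶ X), ev q ≫ u = v q := by
    intro X Z v hadd hcomp
    have h0 : F.map (R X).f ≫ v (R X).p = 0 := by
      rw [← hcomp, (R X).w]
      simpa using hadd (0 : y.obj (R X).B ⟶ X) 0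
    refine ⟨cokernel.desc _ _ h0, fun {A} q => ?_⟩
    obtain ⟨g, rfl⟩ := ex q
    rw [ev_comp, ev_p, Category.assoc, cokernel.π_desc, hcomp]
  have exmap : ∀ {X Y} (α : X ⟶ Y), ∃ u : O X ⟶ O Y, ∀ {A} (q : y.obj A ⟶ X),
      ev q ≫ u = ev (q ≫ α) := fun α =>
    desc (fun q => ev (q ≫ α)) (fun q q' => by simp [ev_add]) (fun g q => by simp [ev_comp])
  choose m hm using @exmap
  let T : E ⥤ B :=
    { obj := O
      map := m
      map_id X := hom_ext _ _ fun A q => by rw [hm]; simp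
      map_comp α β := hom_ext _ _ fun A q => by rw [hm, ← Category.assoc, ← Category.assoc, hm, hm] }
  have hT : T.Additive := ⟨fun {X Y α β} => hom_ext _ _ fun A q => by
    change ev q ≫ m _ = ev q ≫ (m _ + m _)
    rw [Preadditive.comp_add, hm, hm, hm, Preadditive.comp_add, ev_add]⟩
  refine ⟨T, hT, ⟨?_⟩, fun {X Y} α => ?_⟩
  · have exinv : ∀ A, ∃ u : O (y.obj A) ⟶ F.obj A,
        ∀ {A'} (q : y.obj A' ⟶ y.obj A), ev q ≫ u = F.map (y.preimage q) := fun A =>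
      desc (fun q => F.map (y.preimage q))
        (fun q q' => by rw [← F.map_add]; congr 1; apply y.map_injective; simp)
        (fun g q => by rw [← F.map_comp]; congr 1; apply y.map_injective; simp)
    choose i hi using exinv
    refine (NatIso.ofComponents (fun A => ⟨ev (𝟙 (y.obj A)), i A, ?_, ?_⟩) ?_).symm
    · rw [hi]; simp
    · refine hom_ext _ _ fun A' q => ?_
      rw [← Category.assoc, hi, ← ev_comp]
      simp only [Functor.map_preimage, Category.comp_id]
      exact (Category.comp_id _).symm
    · intro A A' g
      change F.map g ≫ ev _ = ev _ ≫ m (y.map g)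
      rw [hm, ← ev_comp]
      simp
  · have hc := cokernelIsCokernel α
    refine preservesColimit_of_preserves_colimit_cocone hc
      ((CokernelCofork.isColimitMapCoconeEquiv _ T).2 ?_)
    have hπ : ∀ {A} (q : y.obj A ⟶ Y), ev q ≫ T.map (cokernel.π α) = ev (q ≫ cokernel.π α) :=
      fun q => hm _ q
    refine Cofork.IsColimit.ofExistsUnique fun s => ?_
    have hs : T.map α ≫ s.π = 0 := CokernelCofork.condition s
    -- To descend `s.π` to the cokernel of `α`, evaluate it on lifts to `Y` of maps into the
    -- cokernel. Two lifts differ by a map coming from `X`, where `s.π` vanishes.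
    have welldef : ∀ {A} (q : y.obj A ⟶ Y), q ≫ cokernel.π α = 0 → ev q ≫ s.π = 0 := by
      intro A q hq
      obtain ⟨r, rfl⟩ := hy.exact _ _ (cokernel.condition α) hc _ hq
      rw [← hm, Category.assoc]
      exact (congrArg _ hs).trans comp_zero
    have exv : ∀ {A} (q : y.obj A ⟶ cokernel α), ∃ v : F.obj A ⟶ s.pt, ∀ r : y.obj A ⟶ Y,
        r ≫ cokernel.π α = q → ev r ≫ s.π = v := by
      intro A q
      obtain ⟨r, hr⟩ := hy.lift _ _ (cokernel.condition α) hc q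
      refine ⟨ev r ≫ s.π, fun r' hr' => ?_⟩
      have h := welldef (r' - r) (by rw [Preadditive.sub_comp, hr, hr', sub_self])
      rw [← sub_add_cancel r' r, ev_add]
      erw [Preadditive.add_comp]
      rw [h, zero_add]
    choose v hv using @exv
    have hv' : ∀ {A} (r : y.obj A ⟶ Y), v (r ≫ cokernel.π α) = ev r ≫ s.π := fun r =>
      (hv _ r rfl).symm
    have hlift : ∀ {A} (q : y.obj A ⟶ cokernel α), ∃ r, r ≫ cokernel.π α = q := fun q =>
      hy.lift _ _ (cokernel.condition α) hc q
    obtain ⟨u, hu⟩ := desc (X := cokernel α) (Z := s.pt) v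
      (fun q q' => by
        obtain ⟨r, rfl⟩ := hlift q
        obtain ⟨r', rfl⟩ := hlift q'
        rw [← Preadditive.add_comp, hv', hv', hv', ev_add]
        exact Preadditive.add_comp _ _ _ _ _ _)
      (fun g q => by
        obtain ⟨r, rfl⟩ := hlift q
        rw [← Category.assoc, hv', hv', ev_comp, Category.assoc])
    refine ⟨u, hom_ext _ _ fun A q => ?_, fun u' hu' => hom_ext _ _ fun A q => ?_⟩
    · exact ((Category.assoc _ _ _).symm.trans (congrArg (· ≫ u) (hπ q))).trans
        ((hu _).trans (hv' q))
    · obtain ⟨r, rfl⟩ := hlift q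
      rw [hu, hv', ← hu', ← hπ]
      exact Category.assoc _ _ _

end IsFreyd

end Freyd

/-! ### Finitely presented functors as the cokernel completion of the opposite category. -/

section Yo

variable (D : Type u) [SmallCategory D] [Preadditive D]

lemma isFP_preadditiveCoyoneda (A : Dᵒᵖ) : IsFP D (preadditiveCoyoneda.obj A) :=
  Pres.isFP ⟨A.unop, A.unop, 0, 𝟙 A.unop, fun x => ⟨x, Category.id_comp x⟩, fun g => by
    change 𝟙 _ ≫ g = 0 ↔ _
    simp [eq_comm]⟩

/-- The embedding `A ↦ (A, -)` of `Dᵒᵖ` in the category of finitely presented functors. -/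
def FP.yo : Dᵒᵖ ⥤ FP D :=
  (IsFP D).lift preadditiveCoyoneda (isFP_preadditiveCoyoneda D) ⋙ (FP.toFull D).inv

/-- `FP.yo` lifts the Yoneda embedding. -/
def FP.yoCompι : FP.yo D ⋙ FP.ι D ≅ preadditiveCoyoneda :=
  Functor.isoWhiskerRight
    (Functor.isoWhiskerLeft ((IsFP D).lift preadditiveCoyoneda (isFP_preadditiveCoyoneda D))
      (FP.toFull D).asEquivalence.counitIso) (IsFP D).ι

instance : (preadditiveCoyoneda : Dᵒᵖ ⥤ D ⥤ AddCommGrpCat.{u}).Additive where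
  map_add {A B f g} := by
    ext X (x : A.unop ⟶ X)
    exact Preadditive.add_comp _ _ _ _ _ _

instance : (FP.yo D).Full :=
  have : (FP.yo D ⋙ FP.ι D).Full := Functor.Full.of_iso (FP.yoCompι D).symm
  Functor.Full.of_comp_faithful _ (FP.ι D)

instance : (FP.yo D).Faithful :=
  have : (FP.yo D ⋙ FP.ι D).Faithful := Functor.Faithful.of_iso (FP.yoCompι D).symm
  Functor.Faithful.of_comp _ (FP.ι D)

instance : (FP.yo D).Additive where
  map_add {A B f g} := by
    apply (FP.ι D).map_injective
    have : (FP.yo D ⋙ FP.ι D).Additive := Functor.additive_of_iso (FP.yoCompι D).symm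
    rw [(FP.ι D).map_add]
    exact (FP.yo D ⋙ FP.ι D).map_add

variable {D}

/-- The element of `X A` corresponding to a morphism `(A, -) ⟶ X`. -/
def FP.elt {A : Dᵒᵖ} {X : FP D} (q : (FP.yo D).obj A ⟶ X) : ((FP.ι D).obj X).obj A.unop :=
  ((FP.yoCompι D).inv.app A ≫ (FP.ι D).map q).app A.unop (𝟙 A.unop)

lemma FP.elt_comp {A : Dᵒᵖ} {X Y : FP D} (q : (FP.yo D).obj A ⟶ X) (α : X ⟶ Y) :
    FP.elt (q ≫ α) = ((FP.ι D).map α).app A.unop (FP.elt q) := by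
  simp only [FP.elt, Functor.map_comp, ← Category.assoc]
  rfl

lemma coyoneda_app (A : Dᵒᵖ) {F : D ⥤ AddCommGrpCat.{u}} (t : preadditiveCoyoneda.obj A ⟶ F)
    {X : D} (x : A.unop ⟶ X) : t.app X x = F.map x (t.app A.unop (𝟙 A.unop)) := by
  refine Eq.trans ?_ (nat_apply t x (𝟙 A.unop)).symm
  exact congrArg _ (Category.id_comp x).symm

lemma coyoneda_ext (A : Dᵒᵖ) {F : D ⥤ AddCommGrpCat.{u}} {t s : preadditiveCoyoneda.obj A ⟶ F}
    (h : t.app A.unop (𝟙 A.unop) = s.app A.unop (𝟙 A.unop)) : t = s := by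
  ext X (x : A.unop ⟶ X)
  exact (coyoneda_app A t x).trans ((congrArg _ h).trans (coyoneda_app A s x).symm)

/-- With `FP.elt_surjective` this is the Yoneda lemma inside `FP D`; it turns lifting problems for
maps out of `(A, -)` into questions about elements of abelian groups. -/
lemma FP.elt_injective {A : Dᵒᵖ} {X : FP D} :
    Function.Injective (FP.elt : ((FP.yo D).obj A ⟶ X) → _) := by
  intro q q' h
  apply (FP.ι D).map_injective
  rw [← cancel_epi ((FP.yoCompι D).inv.app A)]
  exact coyoneda_ext A h

/-- The natural transformation `(A, -) ⟶ F` given by an element of `F A`. -/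
def ofElt {A : Dᵒᵖ} (F : D ⥤ AddCommGrpCat.{u}) [F.Additive] (a : F.obj A.unop) :
    preadditiveCoyoneda.obj A ⟶ F where
  app X := AddCommGrpCat.ofHom
    { toFun := fun g : A.unop ⟶ X => F.map g a
      map_zero' := ConcreteCategory.congr_hom (F.map_zero A.unop X) a
      map_add' := fun g g' => map_add_apply' F g g' a }
  naturality X Y g := by
    ext (x : A.unop ⟶ X)
    exact ConcreteCategory.congr_hom (F.map_comp x g) a

lemma ofElt_app {A : Dᵒᵖ} (F : D ⥤ AddCommGrpCat.{u}) [F.Additive] (a : F.obj A.unop) :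
    (ofElt F a).app A.unop (𝟙 A.unop) = a :=
  ConcreteCategory.congr_hom (F.map_id A.unop) a

lemma FP.elt_surjective {A : Dᵒᵖ} {X : FP D} :
    Function.Surjective (FP.elt : ((FP.yo D).obj A ⟶ X) → _) := by
  intro a
  have := (FP.ι_prop D X).additive_and_pres.1
  refine ⟨(FP.ι D).preimage ((FP.yoCompι D).hom.app A ≫ ofElt _ a), ?_⟩
  simp only [FP.elt, Functor.map_preimage, Iso.inv_hom_id_app_assoc]
  exact ofElt_app _ a

lemma FP.elt_zero {A : Dᵒᵖ} {X : FP D} : FP.elt (0 : (FP.yo D).obj A ⟶ X) = 0 := by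
  simp only [FP.elt, Functor.map_zero, comp_zero]
  rfl

/-- Since `FP.ι` is fully faithful, a cokernel of functors between objects of `FP D` is already a
cokernel there; the work is transport along `FP.yoCompι`. -/
lemma FP.nonempty_cokerPres_of_isColimit {X : FP D} {A B : D} (f : A ⟶ B)
    (π : preadditiveCoyoneda.obj (op A) ⟶ (FP.ι D).obj X)
    (hπ : preadditiveCoyoneda.map f.op ≫ π = 0) (h : IsColimit (CokernelCofork.ofπ π hπ)) :
    Nonempty (CokerPres (FP.yo D) X) := by
  let p : (FP.yo D).obj (op A) ⟶ X := (FP.ι D).preimage ((FP.yoCompι D).hom.app (op A) ≫ π)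
  have hp : (FP.ι D).map p = (FP.yoCompι D).hom.app (op A) ≫ π := Functor.map_preimage _ _
  have hf : (FP.ι D).map ((FP.yo D).map f.op) = (FP.yoCompι D).hom.app (op B) ≫
      preadditiveCoyoneda.map f.op ≫ (FP.yoCompι D).inv.app (op A) :=
    (NatIso.naturality_2 (FP.yoCompι D) f.op).symm
  have w : (FP.yo D).map f.op ≫ p = 0 := by
    apply (FP.ι D).map_injective
    rw [(FP.ι D).map_comp, hp, hf]
    rw [(FP.ι D).map_zero, Category.assoc, Category.assoc, Iso.inv_hom_id_app_assoc, hπ, comp_zero]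
  have hd : ∀ {Z} (k : (FP.yo D).obj (op A) ⟶ Z), (FP.yo D).map f.op ≫ k = 0 →
      preadditiveCoyoneda.map f.op ≫ (FP.yoCompι D).inv.app (op A) ≫ (FP.ι D).map k = 0 := by
    intro Z k hk
    rw [← cancel_epi ((FP.yoCompι D).hom.app (op B))]
    have := congrArg (FP.ι D).map hk
    rw [(FP.ι D).map_comp, hf] at this
    simpa using this
  refine ⟨⟨_, _, f.op, p, w, CokernelCofork.IsColimit.ofπ _ _
    (fun {Z} k hk => (FP.ι D).preimage (CokernelCofork.IsColimit.desc' h _ (hd k hk)).1) ?_ ?_⟩⟩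
  · intro Z k hk
    have e := (CokernelCofork.IsColimit.desc' h _ (hd k hk)).2
    apply (FP.ι D).map_injective
    rw [(FP.ι D).map_comp, hp, (FP.ι D).map_preimage, Category.assoc]
    exact (congrArg _ e).trans (Iso.hom_inv_id_app_assoc _ _ _)
  · intro Z k hk m hm
    have e := (CokernelCofork.IsColimit.desc' h _ (hd k hk)).2
    apply (FP.ι D).map_injective
    rw [(FP.ι D).map_preimage]
    refine Cofork.IsColimit.hom_ext h (Eq.trans ?_ e.symm)
    rw [← hm, (FP.ι D).map_comp, hp, Category.assoc, Iso.inv_hom_id_app_assoc]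
    rfl

lemma FP.nonempty_cokerPres (X : FP D) : Nonempty (CokerPres (FP.yo D) X) :=
  FP.nonempty_cokerPres_of_isColimit (show Arrow D from X).hom _
    (cokernel.condition _) (cokernelIsCokernel _)

variable [HasZeroObject D] [HasBinaryBiproducts D]

/-- Cokernels in `FP D` are computed pointwise, because `FP.ι` preserves finite colimits and
evaluation is exact. -/
lemma FP.app_exact {X Y Z : FP D} (a : X ⟶ Y) (c : Y ⟶ Z) (w : a ≫ c = 0)
    (h : IsColimit (CokernelCofork.ofπ c w)) (A : D) :
    Function.Surjective (((FP.ι D).map c).app A) ∧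
      ∀ x, ((FP.ι D).map c).app A x = 0 → ∃ x', ((FP.ι D).map a).app A x' = x := by
  have w' : (FP.ι D).map a ≫ (FP.ι D).map c = 0 := by rw [← Functor.map_comp, w, Functor.map_zero]
  have h' := CokernelCofork.mapIsColimit _ h (FP.ι D)
  have : Epi ((FP.ι D).map c) := Cofork.IsColimit.epi h'
  refine ⟨(AddCommGrpCat.epi_iff_surjective _).1 inferInstance, ?_⟩
  let S : ShortComplex (D ⥤ AddCommGrpCat.{u}) := ShortComplex.mk _ _ w'
  have hS : S.Exact := S.exact_of_g_is_cokernel h'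
  exact (ShortComplex.ab_exact_iff _).1 (hS.map ((evaluation D AddCommGrpCat.{u}).obj A))

variable (D) in
-- Both lifting properties are `FP.app_exact` read through the Yoneda lemma.
lemma FP.isFreyd_yo : IsFreyd (FP.yo D) where
  full := inferInstance
  faithful := inferInstance
  additive := inferInstance
  lift a c w h A q := by
    obtain ⟨x, hx⟩ := (FP.app_exact a c w h A.unop).1 (FP.elt q)
    obtain ⟨q', rfl⟩ := FP.elt_surjective x
    exact ⟨q', FP.elt_injective (by rw [FP.elt_comp, hx])⟩
  exact a c w h A q hq := by
    obtain ⟨x, hx⟩ := (FP.app_exact a c w h A.unop).2 (FP.elt q)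
      (by rw [← FP.elt_comp, hq, FP.elt_zero])
    obtain ⟨q', rfl⟩ := FP.elt_surjective x
    exact ⟨q', FP.elt_injective (by rw [FP.elt_comp, hx])⟩
  pres := FP.nonempty_cokerPres

variable (D) in
-- Pointwise this is left exactness of `(-, X)`, and `FP.ι` reflects limits. It makes the
-- restriction of an exact functor along `FP.yo` left exact.
instance : PreservesFiniteLimits (FP.yo D) where
  preservesFiniteLimits J _ _ := by
    have : PreservesLimitsOfShape J (preadditiveCoyoneda : Dᵒᵖ ⥤ D ⥤ AddCommGrpCat.{u}) :=
      preservesLimitsOfShape_of_evaluation _ _ fun X =>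
        inferInstanceAs (PreservesLimitsOfShape J (preadditiveYoneda.obj X))
    have := preservesLimitsOfShape_of_natIso (J := J) (FP.yoCompι D).symm
    exact preservesLimitsOfShape_of_reflects_of_preserves _ (FP.ι D)

end Yo

/-! ### When the right exact extension of a functor is exact. -/

section Exactness

/-- A right exact functor is exact if every object has a projective cover `p` such that the functor
preserves the injectivity of the kernel of `p`. -/
lemma preservesFiniteLimits_of_mono_map_kernel {C D : Type*} [Category* C] [Category* D]
    [Abelian C] [Abelian D] (T : C ⥤ D) [T.Additive] [PreservesFiniteColimits T]
    (h : ∀ X : C, ∃ (P : C) (p : P ⟶ X), Projective P ∧ Epi p ∧ Mono (T.map (kernel.ι p))) :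
    PreservesFiniteLimits T := by
  rw [T.preservesFiniteLimits_iff_forall_exact_map_and_mono]
  intro S hS
  refine ⟨((T.preservesFiniteColimits_iff_forall_exact_map_and_epi).1 inferInstance S hS).1, ?_⟩
  have := hS.mono_f
  have := hS.epi_g
  obtain ⟨P, p, _, _, _⟩ := h S.X₃
  let σ : P ⟶ S.X₂ := Projective.factorThru p S.g
  have hσ : σ ≫ S.g = p := Projective.factorThru_comp _ _
  have hk : (kernel.ι p ≫ σ) ≫ S.g = 0 := by rw [Category.assoc, hσ, kernel.condition]
  let t := hS.exact.lift _ hk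
  have ht : t ≫ S.f = kernel.ι p ≫ σ := hS.exact.lift_f _ hk
  -- The map `(S.f, σ)` from `S.X₁ ⊞ P` onto `S.X₂` has kernel `kernel p`, so right exactness of `T`
  -- can be applied to a sequence that starts with `kernel p`.
  let S' : ShortComplex C := ShortComplex.mk (biprod.lift (-t) (kernel.ι p))
    (biprod.desc S.f σ) (by simp [ht])
  have hS' : S'.Exact := by
    rw [ShortComplex.exact_iff_exact_up_to_refinements]
    intro A (y : A ⟶ S.X₁ ⊞ P) hy
    obtain ⟨y₁, y₂, rfl⟩ : ∃ y₁ y₂, y = biprod.lift y₁ y₂ :=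
      ⟨y ≫ biprod.fst, y ≫ biprod.snd, by ext <;> simp⟩
    have hy' : y₁ ≫ S.f + y₂ ≫ σ = 0 := by simpa [S'] using hy
    have h2 : y₂ ≫ p = 0 := by
      have := congrArg (· ≫ S.g) hy'
      simpa [hσ] using this
    refine ⟨A, 𝟙 A, inferInstance, kernel.lift p y₂ h2, ?_⟩
    change 𝟙 A ≫ biprod.lift y₁ y₂ = kernel.lift p y₂ h2 ≫ biprod.lift (-t) (kernel.ι p)
    rw [Category.id_comp]
    ext
    · rw [← cancel_mono S.f]
      simp [ht, eq_neg_iff_add_eq_zero, hy']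
    · simp
  have hS'g : Epi S'.g := by
    rw [Preadditive.epi_iff_cancel_zero]
    intro Z u hu
    have h1 : S.f ≫ u = 0 := by
      rw [← biprod.inl_desc S.f σ, Category.assoc]
      exact (congrArg _ hu).trans comp_zero
    have h2 : σ ≫ u = 0 := by
      rw [← biprod.inr_desc S.f σ, Category.assoc]
      exact (congrArg _ hu).trans comp_zero
    obtain ⟨l, rfl⟩ : ∃ l, S.g ≫ l = u := ⟨_, hS.exact.g_desc u h1⟩
    rw [← Category.assoc, hσ] at h2
    rw [(cancel_epi p).1 (h2.trans comp_zero.symm), comp_zero]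
  have hT : (S'.map T).Exact :=
    ((T.preservesFiniteColimits_tfae.out 3 1 :).1 inferInstance S' ⟨hS', hS'g⟩).1
  rw [Preadditive.mono_iff_cancel_zero]
  intro A x hx
  -- An element `x` killed by `T.map S.f`, seen as `(x, 0)`, comes from some `z`. The second
  -- coordinate says that `T.map (kernel.ι p)` kills `z`, so `z = 0` and then `x = 0`.
  obtain ⟨A', π, _, (z : A' ⟶ T.obj (kernel p)), hz⟩ := hT.exact_up_to_refinements (x ≫ T.map biprod.inl) (by
    change (x ≫ T.map biprod.inl) ≫ T.map (biprod.desc S.f σ) = 0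
    rw [Category.assoc, ← T.map_comp, biprod.inl_desc, hx])
  replace hz : π ≫ x ≫ T.map biprod.inl = z ≫ T.map (biprod.lift (-t) (kernel.ι p)) := hz
  have hz0 : z = 0 := by
    rw [← cancel_mono (T.map (kernel.ι p)), zero_comp, ← biprod.lift_snd (-t) (kernel.ι p),
      T.map_comp, ← Category.assoc, ← hz]
    simp only [Category.assoc, ← T.map_comp, biprod.inl_snd, T.map_zero, comp_zero]
  rw [hz0, zero_comp] at hz
  have := congrArg (· ≫ T.map biprod.fst) hz
  simp only [Category.assoc, ← T.map_comp, biprod.inl_fst, T.map_id, Category.comp_id,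
    zero_comp] at this
  exact (cancel_epi π).1 (this.trans comp_zero.symm)

universe v₁ v₂ v₃ u₁ u₂ u₃

variable {P : Type u₁} [Category.{v₁} P] [Preadditive P]
  {E : Type u₂} [Category.{v₂} E] [Abelian E] {B : Type u₃} [Category.{v₃} B] [Abelian B]

/-- An epimorphism `c` in an abelian category is the cokernel of its kernel, so the lifting property
in `IsFreyd` applies to it. -/
lemma IsFreyd.projective {y : P ⥤ E} (hy : IsFreyd y) (A : P) : Projective (y.obj A) where
  factors q c _ := by
    have h : (ShortComplex.mk _ _ (kernel.condition c)).Exact := ShortComplex.exact_kernel c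
    have : Epi (ShortComplex.mk _ _ (kernel.condition c)).g := inferInstanceAs (Epi c)
    exact hy.lift _ _ (kernel.condition c) h.gIsCokernel q

/-- If `y` is left exact, the right exact extension of a left exact functor is exact. -/
lemma IsFreyd.preservesFiniteLimits {y : P ⥤ E} (hy : IsFreyd y) [HasKernels P] [y.Additive]
    [PreservesFiniteLimits y] (T : E ⥤ B) [T.Additive] [PreservesFiniteColimits T]
    [PreservesFiniteLimits (y ⋙ T)] : PreservesFiniteLimits T := by
  refine preservesFiniteLimits_of_mono_map_kernel T fun X => ?_
  obtain ⟨R⟩ := hy.pres X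
  have : Epi R.p := Cofork.IsColimit.epi R.isColimit
  refine ⟨_, R.p, hy.projective _, this, ?_⟩
  let S : ShortComplex E := ShortComplex.mk _ _ R.w
  have hS : S.Exact := S.exact_of_g_is_cokernel R.isColimit
  -- `e` covers `kernel R.p` by `y B`. An element of `T (kernel R.p)` killed in `T (y A)` lifts
  -- along `T e` to one killed by `T (y f)`. By left exactness of `y ⋙ T` this comes from `kernel
  -- f`, and `e` kills `y (kernel f)`.
  let e := kernel.lift R.p (y.map R.f) R.w
  have he : e ≫ kernel.ι R.p = y.map R.f := kernel.lift_ι _ _ _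
  have : Epi e := hS.epi_kernelLift
  have hl := KernelFork.mapIsLimit _ (kernelIsKernel R.f) (y ⋙ T)
  have hn : y.map (kernel.ι R.f) ≫ e = 0 := by
    rw [← cancel_mono (kernel.ι R.p), Category.assoc, he, ← y.map_comp, kernel.condition,
      y.map_zero, zero_comp]
  rw [Preadditive.mono_iff_cancel_zero]
  intro A x hx
  obtain ⟨A', π, _, z, hz⟩ := surjective_up_to_refinements_of_epi (T.map e) x
  have hz' : z ≫ (y ⋙ T).map R.f = 0 := by
    change z ≫ T.map (y.map R.f) = 0
    rw [← he, T.map_comp, ← Category.assoc, ← hz, Category.assoc, hx, comp_zero]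
  obtain ⟨(l : A' ⟶ T.obj (y.obj (kernel R.f))), hl⟩ := KernelFork.IsLimit.lift' hl z hz'
  replace hl : l ≫ T.map (y.map (kernel.ι R.f)) = z := hl
  rw [← hl, Category.assoc, ← T.map_comp, hn, T.map_zero, comp_zero] at hz
  exact (cancel_epi π).1 (hz.trans comp_zero.symm)

end Exactness

/-! ### Extension of additive functors to the additive completion. -/

section MatExtension

variable {R : Type w} [Category.{u} R] [Preadditive R]
  {B : Type v} [Category.{u} B] [Preadditive B]

/-- The extension of an additive functor to `Mat_ R`; unlike `Mat_.lift`, it has no restriction on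
the universe of the target. -/
def matLift [HasFiniteBiproducts B] (F : R ⥤ B) [F.Additive] : Mat_ R ⥤ B where
  obj X := ⨁ fun i => F.obj (X.X i)
  map f := biproduct.matrix fun i j => F.map (f i j)
  map_id X := by
    refine biproduct.hom_ext _ _ fun i => biproduct.hom_ext' _ _ fun j => ?_
    by_cases h : j = i
    · subst h; simp
    · simp [h]
  map_comp f g := by
    refine biproduct.hom_ext _ _ fun i => biproduct.hom_ext' _ _ fun j => ?_
    simp [biproduct.lift_desc]

instance [HasFiniteBiproducts B] (F : R ⥤ B) [F.Additive] : (matLift F).Additive where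
  map_add {X Y f g} := by
    refine biproduct.hom_ext _ _ fun i => biproduct.hom_ext' _ _ fun j => ?_
    simp only [matLift]
    erw [Preadditive.add_comp, Preadditive.comp_add]
    simp

/-- A biproduct over a one-point type. -/
def biproductPUnit [HasFiniteBiproducts B] (Y : B) : (⨁ fun _ : PUnit.{1} => Y) ≅ Y where
  hom := biproduct.π (fun _ : PUnit.{1} => Y) PUnit.unit
  inv := biproduct.ι (fun _ : PUnit.{1} => Y) PUnit.unit
  hom_inv_id := by
    refine biproduct.hom_ext _ _ fun _ => biproduct.hom_ext' _ _ fun _ => ?_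
    simp

lemma biproductPUnit_naturality [HasFiniteBiproducts B] {Y Z : B} (f : Y ⟶ Z) :
    biproduct.matrix (fun _ _ : PUnit.{1} => f) ≫ (biproductPUnit Z).hom =
      (biproductPUnit Y).hom ≫ f := by
  refine biproduct.hom_ext' _ _ fun _ => ?_
  simp [biproductPUnit]

/-- `matLift F` extends `F`. -/
def embeddingMatLift [HasFiniteBiproducts B] (F : R ⥤ B) [F.Additive] :
    Mat_.embedding R ⋙ matLift F ≅ F :=
  NatIso.ofComponents (fun X => biproductPUnit (F.obj X))
    fun f => biproductPUnit_naturality (F.map f)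

/-- Each object is the biproduct of its entries, so the component there must be the sum over the
entries of `φ` conjugated by projection and inclusion. -/
lemma exists_mat_natTrans {K K' : Mat_ R ⥤ B} [K.Additive] [K'.Additive]
    (φ : Mat_.embedding R ⋙ K ⟶ Mat_.embedding R ⋙ K') :
    ∃ ψ : K ⟶ K', ∀ r, ψ.app ((Mat_.embedding R).obj r) = φ.app r := by
  let π (X : Mat_ R) (i : X.ι) : X ⟶ (Mat_.embedding R).obj (X.X i) :=
    X.isoBiproductEmbedding.hom ≫ biproduct.π _ i
  let ι (X : Mat_ R) (i : X.ι) : (Mat_.embedding R).obj (X.X i) ⟶ X :=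
    biproduct.ι (fun i => (Mat_.embedding R).obj (X.X i)) i ≫ X.isoBiproductEmbedding.inv
  have total : ∀ X, ∑ i, π X i ≫ ι X i = 𝟙 X := by
    intro X
    have h : ∀ i, π X i ≫ ι X i = X.isoBiproductEmbedding.hom ≫
        (biproduct.π (fun i => (Mat_.embedding R).obj (X.X i)) i ≫
          biproduct.ι (fun i => (Mat_.embedding R).obj (X.X i)) i) ≫
          X.isoBiproductEmbedding.inv := fun i => by
      simp only [π, ι, Category.assoc]
    simp only [h]
    rw [← Preadditive.comp_sum, ← Preadditive.sum_comp, biproduct.total, Category.id_comp,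
      Iso.hom_inv_id]
  let ψ (X : Mat_ R) : K.obj X ⟶ K'.obj X := ∑ i, K.map (π X i) ≫ φ.app _ ≫ K'.map (ι X i)
  have key : ∀ {r : R} {X : Mat_ R} (q : (Mat_.embedding R).obj r ⟶ X),
      K.map q ≫ ψ X = φ.app r ≫ K'.map q := by
    intro r X q
    have h : ∀ i, K.map q ≫ K.map (π X i) ≫ φ.app _ ≫ K'.map (ι X i) =
        φ.app r ≫ K'.map q ≫ K'.map (π X i ≫ ι X i) := by
      intro i
      have hn := φ.naturality ((Mat_.embedding R).preimage (q ≫ π X i))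
      simp only [Functor.comp_map, Functor.map_preimage, K.map_comp, K'.map_comp,
        Category.assoc] at hn
      rw [reassoc_of% hn, K'.map_comp (π X i)]
    simp only [ψ, Preadditive.comp_sum, h]
    rw [← Preadditive.comp_sum, ← Preadditive.comp_sum, ← K'.map_sum, total, K'.map_id,
      Category.comp_id]
  refine ⟨⟨ψ, fun X Y f => ?_⟩, fun r => ?_⟩
  · rw [← Category.id_comp (K.map f), ← K.map_id, ← total X, K.map_sum, Preadditive.sum_comp,
      Preadditive.sum_comp]
    simp only [ψ, Preadditive.sum_comp]
    refine Finset.sum_congr rfl fun i _ => ?_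
    have := key (ι X i ≫ f)
    rw [K.map_comp, Category.assoc, K'.map_comp] at this
    simp only [K.map_comp, Category.assoc]
    rw [this]
  · simpa using key (𝟙 ((Mat_.embedding R).obj r))

lemma mat_natTrans_ext {K K' : Mat_ R ⥤ B} [K.Additive] {ψ ψ' : K ⟶ K'}
    (h : ∀ r, ψ.app ((Mat_.embedding R).obj r) = ψ'.app ((Mat_.embedding R).obj r)) : ψ = ψ' := by
  ext X
  have e := X.isoBiproductEmbedding
  have hK := isBilimitOfPreserves K
    (biproduct.isBilimit fun i => (Mat_.embedding R).obj (X.X i))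
  rw [← cancel_epi (K.map e.inv), ψ.naturality, ψ'.naturality]
  congr 1
  refine hK.isColimit.hom_ext fun ⟨i⟩ => ?_
  change K.map (biproduct.ι _ i) ≫ _ = K.map (biproduct.ι _ i) ≫ _
  rw [ψ.naturality, ψ'.naturality, h]

lemma mat_nonempty_iso {K K' : Mat_ R ⥤ B} [K.Additive] [K'.Additive]
    (φ : Mat_.embedding R ⋙ K ≅ Mat_.embedding R ⋙ K') : Nonempty (K ≅ K') := by
  obtain ⟨ψ, hψ⟩ := exists_mat_natTrans φ.hom
  obtain ⟨ψ', hψ'⟩ := exists_mat_natTrans φ.inv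
  refine ⟨⟨ψ, ψ', ?_, ?_⟩⟩ <;> refine mat_natTrans_ext fun r => ?_
  · rw [NatTrans.comp_app, hψ, hψ', Iso.hom_inv_id_app]; rfl
  · rw [NatTrans.comp_app, hψ, hψ', Iso.inv_hom_id_app]; rfl

end MatExtension

/-! ### The universal property of the free abelian category. -/

section FreeAbelian

variable (R : Type w) [Category.{u} R] [Preadditive R] [EssentiallySmall.{u} R]

instance : (AddClosure.toMat R).inv.Additive :=
  have : (AddClosure.toMat R).asEquivalence.functor.Additive :=
    inferInstanceAs (AddClosure.toMat R).Additive
  inferInstanceAs (AddClosure.toMat R).asEquivalence.inverse.Additive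

/-- The embedding of `R` in its additive completion. -/
def AddClosure.of : R ⥤ AddClosure R := Mat_.embedding R ⋙ (AddClosure.toMat R).inv

instance : (AddClosure.of R).Additive :=
  inferInstanceAs (Mat_.embedding R ⋙ (AddClosure.toMat R).inv).Additive

/-- The embedding of the additive completion of `R` in the free abelian category on `R`. -/
def AddClosure.toFreeAb : AddClosure R ⥤ FreeAb R :=
  (FP.yo (AddClosure R)).rightOp ⋙ FP.yo (FpMod R)

instance : (AddClosure.toFreeAb R).Additive :=
  inferInstanceAs ((FP.yo (AddClosure R)).rightOp ⋙ FP.yo (FpMod R)).Additive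

/-- The embedding of `R` in the free abelian category on `R`. -/
def FreeAb.of : R ⥤ FreeAb R := AddClosure.of R ⋙ AddClosure.toFreeAb R

variable {R} {B : Type v} [Category.{u} B]

lemma AddClosure.nonempty_iso [Preadditive B] {K K' : AddClosure R ⥤ B} [K.Additive] [K'.Additive]
    (φ : AddClosure.of R ⋙ K ≅ AddClosure.of R ⋙ K') : Nonempty (K ≅ K') := by
  obtain ⟨e⟩ := mat_nonempty_iso (K := (AddClosure.toMat R).inv ⋙ K)
    (K' := (AddClosure.toMat R).inv ⋙ K') φ
  let i := (AddClosure.toMat R).asEquivalence.unitIso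
  exact ⟨K.leftUnitor.symm ≪≫ Functor.isoWhiskerRight i K ≪≫
    Functor.isoWhiskerLeft (AddClosure.toMat R) e ≪≫
    (Functor.isoWhiskerRight i K').symm ≪≫ K'.leftUnitor⟩

/-- The extension of an additive functor to the additive completion. -/
def AddClosure.lift [Preadditive B] [HasFiniteBiproducts B] (F : R ⥤ B) [F.Additive] : AddClosure R ⥤ B := AddClosure.toMat R ⋙ matLift F

instance [Preadditive B] [HasFiniteBiproducts B] (F : R ⥤ B) [F.Additive] :
    (AddClosure.lift F).Additive :=
  inferInstanceAs (AddClosure.toMat R ⋙ matLift F).Additive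

/-- `AddClosure.lift F` extends `F`. -/
def AddClosure.ofCompLift [Preadditive B] [HasFiniteBiproducts B] (F : R ⥤ B) [F.Additive] :
    AddClosure.of R ⋙ AddClosure.lift F ≅ F :=
  Functor.isoWhiskerLeft (Mat_.embedding R)
    (Functor.isoWhiskerRight (AddClosure.toMat R).asEquivalence.counitIso (matLift F)) ≪≫
    embeddingMatLift F

variable [Abelian B]

/-- The universal property of the free abelian category: every additive functor to an abelian
category extends to an exact functor. -/
theorem FreeAb.exists_extension (F : R ⥤ B) [F.Additive] : ∃ T : FreeAb R ⥤ B,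
    PreservesFiniteLimits T ∧ PreservesFiniteColimits T ∧ Nonempty (FreeAb.of R ⋙ T ≅ F) := by
  have := Abelian.hasFiniteBiproducts (C := B)
  let K := AddClosure.lift F
  -- `FpMod R` completes the opposite of `AddClosure R`, so the extension is made with values in
  -- `Bᵒᵖ`: `T₁` is right exact there, hence `T₁.leftOp` is left exact with values in `B`.
  obtain ⟨T₁, _, ⟨e₁⟩, h₁⟩ := (FP.isFreyd_yo (AddClosure R)).exists_extension K.op
  have := @h₁
  have : PreservesFiniteColimits T₁ := Functor.preservesFiniteColimits_of_preservesCokernels T₁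
  have := preservesFiniteLimits_leftOp T₁
  obtain ⟨T₂, _, ⟨e₂⟩, h₂⟩ := (FP.isFreyd_yo (FpMod R)).exists_extension T₁.leftOp
  have := @h₂
  have hT₂ : PreservesFiniteColimits T₂ := Functor.preservesFiniteColimits_of_preservesCokernels T₂
  have : PreservesFiniteLimits (FP.yo (FpMod R) ⋙ T₂) :=
    ⟨fun J _ _ => preservesLimitsOfShape_of_natIso e₂.symm⟩
  refine ⟨T₂, (FP.isFreyd_yo (FpMod R)).preservesFiniteLimits T₂, hT₂, ⟨?_⟩⟩
  let e₃ : (FP.yo (AddClosure R)).rightOp ⋙ T₁.leftOp ≅ K :=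
    NatIso.ofComponents (fun X => (e₁.app (op X)).symm.unop) fun f => by
      apply Quiver.Hom.op_inj
      exact (e₁.inv.naturality f.op).symm
  exact Functor.isoWhiskerLeft (AddClosure.of R)
    (Functor.isoWhiskerLeft (FP.yo (AddClosure R)).rightOp e₂ ≪≫ e₃) ≪≫ AddClosure.ofCompLift F

/-- Exact functors on the free abelian category which agree on `R` are isomorphic. -/
theorem FreeAb.nonempty_iso {T T' : FreeAb R ⥤ B} [PreservesFiniteLimits T]
    [PreservesFiniteColimits T] [PreservesFiniteLimits T'] [PreservesFiniteColimits T']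
    (φ : FreeAb.of R ⋙ T ≅ FreeAb.of R ⋙ T') : Nonempty (T ≅ T') := by
  have : T.Additive := T.additive_of_preserves_binary_products
  have : T'.Additive := T'.additive_of_preserves_binary_products
  obtain ⟨e₁⟩ := AddClosure.nonempty_iso (K := AddClosure.toFreeAb R ⋙ T)
    (K' := AddClosure.toFreeAb R ⋙ T') φ
  -- `T` is determined by `L`. As `L` is left exact, `L.rightOp` is right exact on `FpMod R`, hence
  -- determined on representable modules, where `e₁` gives the agreement.
  let L := FP.yo (FpMod R) ⋙ T
  let L' := FP.yo (FpMod R) ⋙ T'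
  have := preservesFiniteColimits_rightOp L
  have := preservesFiniteColimits_rightOp L'
  let e₂ : FP.yo (AddClosure R) ⋙ L.rightOp ≅ FP.yo (AddClosure R) ⋙ L'.rightOp :=
    NatIso.ofComponents (fun X => (e₁.app X.unop).symm.op) fun f => by
      apply Quiver.Hom.unop_inj
      exact (e₁.inv.naturality f.unop).symm
  obtain ⟨e₃⟩ := (FP.isFreyd_yo (AddClosure R)).nonempty_iso e₂
  let e₄ : L ≅ L' := NatIso.ofComponents (fun X => (e₃.app X.unop).symm.unop) fun f => by
    apply Quiver.Hom.op_inj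
    exact (e₃.inv.naturality f.unop).symm
  exact (FP.isFreyd_yo (FpMod R)).nonempty_iso e₄

end FreeAbelian

/-! ### The exact extension of a module restricts to the module. -/

section Tilde

lemma FP.elt_add {D : Type u} [SmallCategory D] [Preadditive D] {A : Dᵒᵖ} {X : FP D}
    (q q' : (FP.yo D).obj A ⟶ X) : FP.elt (q + q') = FP.elt q + FP.elt q' := by
  simp only [FP.elt, (FP.ι D).map_add, Preadditive.comp_add]
  rfl

lemma FP.elt_precomp {D : Type u} [SmallCategory D] [Preadditive D] {A A' : Dᵒᵖ} {X : FP D}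
    (f : A ⟶ A') (q : (FP.yo D).obj A' ⟶ X) :
    FP.elt ((FP.yo D).map f ≫ q) = ((FP.ι D).obj X).map f.unop (FP.elt q) := by
  have h := (FP.yoCompι D).inv.naturality f
  dsimp at h
  simp only [FP.elt, (FP.ι D).map_comp]
  rw [← reassoc_of% h]
  refine (coyoneda_app A' ((FP.yoCompι D).inv.app A' ≫ (FP.ι D).map q) _).trans ?_
  refine congrArg (fun t => ((FP.ι D).obj X).map t _) ?_
  exact Category.comp_id f.unop

/-- The value at `A` of a natural transformation from `X`, as a function of the maps
`(A, -) ⟶ X`. -/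
def FP.evalHom {D : Type u} [SmallCategory D] [Preadditive D] (A : Dᵒᵖ) {X : FP D}
    {F : D ⥤ AddCommGrpCat.{u}} (t : (FP.ι D).obj X ⟶ F) :
    ((FP.yo D).obj A ⟶ X) →+ F.obj A.unop where
  toFun q := t.app A.unop (FP.elt q)
  map_zero' := (congrArg _ FP.elt_zero).trans (map_zero _)
  map_add' q q' := (congrArg _ (FP.elt_add q q')).trans (map_add _ _ _)

lemma FP.evalHom_comp {D : Type u} [SmallCategory D] [Preadditive D] (A : Dᵒᵖ) {X Y : FP D}
    {F : D ⥤ AddCommGrpCat.{u}} (t : (FP.ι D).obj Y ⟶ F) (q : (FP.yo D).obj A ⟶ X) (α : X ⟶ Y) :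
    FP.evalHom A t (q ≫ α) = FP.evalHom A ((FP.ι D).map α ≫ t) q :=
  congrArg _ (FP.elt_comp q α)

lemma FP.evalHom_precomp {D : Type u} [SmallCategory D] [Preadditive D] {A A' : Dᵒᵖ} {X : FP D}
    {F : D ⥤ AddCommGrpCat.{u}} (t : (FP.ι D).obj X ⟶ F) (f : A ⟶ A')
    (q : (FP.yo D).obj A' ⟶ X) :
    FP.evalHom A t ((FP.yo D).map f ≫ q) = F.map f.unop (FP.evalHom A' t q) :=
  (congrArg _ (FP.elt_precomp f q)).trans (nat_apply t f.unop (FP.elt q)).symm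

lemma FP.evalHom_id {D : Type u} [SmallCategory D] [Preadditive D] {A : Dᵒᵖ}
    {F : D ⥤ AddCommGrpCat.{u}} (t : (FP.ι D).obj ((FP.yo D).obj A) ⟶ F) :
    FP.evalHom A t (𝟙 _) = ((FP.yoCompι D).inv.app A ≫ t).app A.unop (𝟙 A.unop) := by
  have h : (FP.yoCompι D).inv.app A ≫ (FP.ι D).map (𝟙 ((FP.yo D).obj A)) =
      (FP.yoCompι D).inv.app A := by
    rw [(FP.ι D).map_id]
    exact Category.comp_id _
  exact congrArg (fun s : preadditiveCoyoneda.obj A ⟶ _ => t.app A.unop (s.app A.unop (𝟙 A.unop))) h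

lemma FP.eq_zero_of_evalHom {D : Type u} [SmallCategory D] [Preadditive D] {A : Dᵒᵖ}
    {F : D ⥤ AddCommGrpCat.{u}} {t : (FP.ι D).obj ((FP.yo D).obj A) ⟶ F}
    (h : FP.evalHom A t (𝟙 _) = 0) : t = 0 := by
  rw [← cancel_epi ((FP.yoCompι _).inv.app A), comp_zero]
  exact coyoneda_ext A ((FP.evalHom_id t).symm.trans h)

lemma FP.exists_evalHom {D : Type u} [SmallCategory D] [Preadditive D] {A : Dᵒᵖ}
    {F : D ⥤ AddCommGrpCat.{u}} [F.Additive] (x : F.obj A.unop) :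
    ∃ t : (FP.ι D).obj ((FP.yo D).obj A) ⟶ F, FP.evalHom A t (𝟙 _) = x := by
  refine ⟨(FP.yoCompι D).hom.app A ≫ ofElt F x, ?_⟩
  rw [FP.evalHom_id, Iso.inv_hom_id_app_assoc, ofElt_app]

variable {R : Type w} [Category.{u} R] [Preadditive R] [EssentiallySmall.{u} R]
  (M : R ⥤ AddCommGrpCat.{u}) [M.Additive]

/-- The diagram of the maps from a representable module to the finitely presented modules
over `M`. -/
abbrev homDiagram (c : AddClosure R) : Approx M ⥤ AddCommGrpCat.{u} :=
  CostructuredArrow.proj (FP.ι (AddClosure R)) (extMod M) ⋙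
    preadditiveCoyoneda.obj (op ((FP.yo (AddClosure R)).obj (op c)))

/-- The class of a map in the colimit of `homDiagram M c`. -/
def homClass {c : AddClosure R} {a : Approx M}
    (q : (FP.yo (AddClosure R)).obj (op c) ⟶ a.left) : ↑(colimit (homDiagram M c)) :=
  colimit.ι (homDiagram M c) a q

lemma homClass_comp {c : AddClosure R} {a b : Approx M} (f : a ⟶ b)
    (q : (FP.yo (AddClosure R)).obj (op c) ⟶ a.left) :
    homClass M (a := b) (q ≫ f.left) = homClass M q :=
  ConcreteCategory.congr_hom (colimit.w (homDiagram M c) f) q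

lemma homClass_zero {c : AddClosure R} {a : Approx M} :
    homClass M (a := a) (0 : (FP.yo (AddClosure R)).obj (op c) ⟶ a.left) = 0 :=
  map_zero (colimit.ι (homDiagram M c) a).hom

lemma exists_homClass {c : AddClosure R} (z : ↑(colimit (homDiagram M c))) :
    ∃ (a : Approx M) (q : (FP.yo (AddClosure R)).obj (op c) ⟶ a.left), homClass M q = z :=
  Concrete.colimit_exists_rep _ z

/-- The evaluation of the maps from a representable module to the modules over `M`. -/
def evalCocone (c : AddClosure R) : Cocone (homDiagram M c) where
  pt := (extMod M).obj c
  ι :=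
    { app a := AddCommGrpCat.ofHom (FP.evalHom (op c) a.hom)
      naturality a b f := by
        ext (q : (FP.yo (AddClosure R)).obj (op c) ⟶ a.left)
        refine (FP.evalHom_comp (op c) b.hom q f.left).trans ?_
        rw [CostructuredArrow.w f]
        rfl }

/-- The map from the colimit of `homDiagram M c` to `M c`. -/
def evalMap (c : AddClosure R) : colimit (homDiagram M c) ⟶ (extMod M).obj c :=
  colimit.desc _ (evalCocone M c)

lemma evalMap_homClass {c : AddClosure R} {a : Approx M}
    (q : (FP.yo (AddClosure R)).obj (op c) ⟶ a.left) :
    evalMap M c (homClass M q) = FP.evalHom (op c) a.hom q :=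
  ConcreteCategory.congr_hom (colimit.ι_desc (evalCocone M c) a) q

/-- The image of `c` in `FreeAb R` is the functor `Hom((c, -), A)` of `A`, so this bijection
computes `tilde M` there. Surjectivity is Yoneda: an element of `M c` is a map `(c, -) ⟶ M`, itself
an object of `Approx M`. -/
lemma evalMap_bijective (c : AddClosure R) : Function.Bijective (evalMap M c) := by
  constructor
  · rw [injective_iff_map_eq_zero]
    intro z hz
    obtain ⟨a, q, rfl⟩ := exists_homClass M z
    rw [evalMap_homClass, ← Category.id_comp q, FP.evalHom_comp] at hz
    -- If `q` evaluates to zero, it is a morphism to `a` from `(c, -)` with the zero map to `M`.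
    -- There the zero endomorphism is also allowed, and it identifies the class of the identity with
    -- that of `0`.
    let a₀ : Approx M := CostructuredArrow.mk
      (0 : (FP.ι (AddClosure R)).obj ((FP.yo (AddClosure R)).obj (op c)) ⟶ extMod M)
    let f : a₀ ⟶ a := CostructuredArrow.homMk q (FP.eq_zero_of_evalHom hz)
    let g : a₀ ⟶ a₀ := CostructuredArrow.homMk 0 comp_zero
    have e₁ : homClass M q = homClass M (a := a₀) (𝟙 _) :=
      (congrArg (homClass M) (Category.id_comp q).symm).trans
        (homClass_comp M f (𝟙 ((FP.yo (AddClosure R)).obj (op c))))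
    have e₂ : homClass M (a := a₀) 0 = homClass M (a := a₀) (𝟙 _) :=
      (congrArg (homClass M) (Category.id_comp _).symm).trans
        (homClass_comp M g (𝟙 ((FP.yo (AddClosure R)).obj (op c))))
    rw [e₁, ← e₂, homClass_zero]
  · intro x
    obtain ⟨t, ht⟩ := FP.exists_evalHom (A := op c) (F := extMod M) x
    exact ⟨homClass M (a := CostructuredArrow.mk t) (𝟙 _), (evalMap_homClass M _).trans ht⟩

instance (c : AddClosure R) : IsIso (evalMap M c) := by
  rw [ConcreteCategory.isIso_iff_bijective]
  exact evalMap_bijective M c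

/-- The colimit of `homDiagram M c` is natural in `c`. -/
def homColim : AddClosure R ⥤ AddCommGrpCat.{u} :=
  (FP.yo (AddClosure R)).rightOp ⋙ preadditiveCoyoneda ⋙ (Functor.whiskeringLeft _ _ _).obj
      (CostructuredArrow.proj (FP.ι (AddClosure R)) (extMod M)) ⋙ colim

lemma homColim_map {c c' : AddClosure R} (f : c ⟶ c') {a : Approx M}
    (q : (FP.yo (AddClosure R)).obj (op c) ⟶ a.left) :
    (homColim M).map f (homClass M q) = homClass M (a := a) ((FP.yo (AddClosure R)).map f.op ≫ q) :=
  ConcreteCategory.congr_hom (ι_colimMap (Functor.whiskerLeft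
    (CostructuredArrow.proj (FP.ι (AddClosure R)) (extMod M)) (preadditiveCoyoneda.map
      ((FP.yo (AddClosure R)).map f.op).op)) a) q

/-- The colimit of `homDiagram M c` is `M c`. -/
def homColimIso : homColim M ≅ extMod M :=
  NatIso.ofComponents (fun c => @asIso _ _ (colimit (homDiagram M c)) _ (evalMap M c) _) (fun {c c'} f => by
    ext z
    obtain ⟨a, q, rfl⟩ := exists_homClass M z
    refine (congrArg _ (homColim_map M f q)).trans ?_
    refine (evalMap_homClass M _).trans ((FP.evalHom_precomp a.hom f.op q).trans ?_)
    exact congrArg _ (evalMap_homClass M q).symm)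

/-- The exact extension of `M` to the free abelian category restricts to the additive extension
of `M`. -/
def toFreeAbCompTilde : AddClosure.toFreeAb R ⋙ tilde M ≅ extMod M :=
  Functor.isoWhiskerLeft (FP.yo (AddClosure R)).rightOp
    (Functor.isoWhiskerRight (FP.yoCompι (FpMod R)) ((Functor.whiskeringLeft _ _ _).obj
      (CostructuredArrow.proj (FP.ι (AddClosure R)) (extMod M)) ⋙ colim)) ≪≫ homColimIso M

/-- The exact extension of `M` to the free abelian category restricts to `M`. -/
def ofCompTilde : FreeAb.of R ⋙ tilde M ≅ M :=
  Functor.isoWhiskerLeft (AddClosure.of R) (toFreeAbCompTilde M) ≪≫ AddClosure.ofCompLift M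

end Tilde

/-! ### Faithful exact functors and their sections. -/

section ExactFunctors

variable {C D : Type*} [Category* C] [Category* D] [Abelian C] [Abelian D]

/-- An exact functor which reflects zero objects is faithful. -/
lemma faithful_of_isZero (G : C ⥤ D) [PreservesFiniteLimits G] [PreservesFiniteColimits G]
    (h : ∀ X, IsZero (G.obj X) → IsZero X) : G.Faithful := by
  have : G.Additive := G.additive_of_preserves_binary_products
  have key : ∀ {X Y : C} (f : X ⟶ Y), G.map f = 0 → f = 0 := by
    intro X Y f hf
    -- `G` preserves the epi-mono factorization of `f`, so `G.map f = 0` forces the image of `f` to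
    -- go to zero.
    rw [← Abelian.image.fac f, G.map_comp] at hf
    have h0 : G.map (Abelian.factorThruImage f) = 0 := by
      rwa [← cancel_mono (G.map (Abelian.image.ι f)), zero_comp]
    have hz := h _ (IsZero.of_epi_eq_zero _ h0)
    rw [← Abelian.image.fac f, hz.eq_zero_of_tgt (Abelian.factorThruImage f), zero_comp]
  exact ⟨fun {X Y f g} e => sub_eq_zero.1 (key _ (by rw [G.map_sub, e, sub_self]))⟩

omit [Abelian D] in
/-- If `s ⋙ J` is the identity and `J` is faithful and exact, then `s` is exact. -/
lemma exact_of_section (J : C ⥤ D) [J.Faithful] [PreservesFiniteLimits J]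
    [PreservesFiniteColimits J] (s : D ⥤ C) (η : s ⋙ J ≅ 𝟭 D) :
    PreservesFiniteLimits s ∧ PreservesFiniteColimits s := by
  refine ⟨⟨fun K _ _ => ?_⟩, ⟨fun K _ _ => ?_⟩⟩
  -- A faithful functor on an abelian category reflects isomorphisms, so `J` reflects the finite
  -- limits that it preserves.
  · have := preservesLimitsOfShape_of_natIso (J := K) η.symm
    have : ReflectsLimitsOfShape K J := reflectsLimitsOfShape_of_reflectsIsomorphisms
    exact preservesLimitsOfShape_of_reflects_of_preserves s J
  · have := preservesColimitsOfShape_of_natIso (J := K) η.symm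
    have : ReflectsColimitsOfShape K J := reflectsColimitsOfShape_of_reflectsIsomorphisms
    exact preservesColimitsOfShape_of_reflects_of_preserves s J

end ExactFunctors

/-! ### Functors induced on Serre quotients. -/

section SerreQuotient

variable {A : Type u} [SmallCategory A] [Abelian A] (P : ObjectProperty A) [P.IsSerreClass]
  {E : Type w} [Category.{v} E] [Abelian E]

instance : PreservesFiniteLimits (P.isoModSerre.Q : A ⥤ SerreQuotient P) :=
  ObjectProperty.SerreClassLocalization.preservesFiniteLimits P.isoModSerre.Q P

instance : PreservesFiniteColimits (P.isoModSerre.Q : A ⥤ SerreQuotient P) :=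
  ObjectProperty.SerreClassLocalization.preservesFiniteColimits P.isoModSerre.Q P

variable (G : A ⥤ E) (hG : P.isoModSerre.IsInvertedBy G)

/-- Left exactness on the quotient can be tested after composing with `Q`, where the lift becomes
`G`. -/
lemma preservesFiniteLimits_lift [PreservesFiniteLimits G] :
    PreservesFiniteLimits (Localization.lift G hG P.isoModSerre.Q) := by
  rw [← ObjectProperty.SerreClassLocalization.preservesFiniteLimits_comp_iff P.isoModSerre.Q P]
  exact ⟨fun J _ _ => preservesLimitsOfShape_of_natIso
    (Localization.fac G hG P.isoModSerre.Q).symm⟩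

lemma preservesFiniteColimits_lift [PreservesFiniteColimits G] :
    PreservesFiniteColimits (Localization.lift G hG P.isoModSerre.Q) := by
  rw [← ObjectProperty.SerreClassLocalization.preservesFiniteColimits_comp_iff P.isoModSerre.Q P]
  exact ⟨fun J _ _ => preservesColimitsOfShape_of_natIso
    (Localization.fac G hG P.isoModSerre.Q).symm⟩

/-- Every object of the quotient is some `Q X`, which is zero exactly when `P X`; thus the lift
reflects zero objects. -/
lemma faithful_lift [PreservesFiniteLimits G] [PreservesFiniteColimits G]
    (h : ∀ X, IsZero (G.obj X) → P X) :
    (Localization.lift G hG P.isoModSerre.Q).Faithful := by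
  have := preservesFiniteLimits_lift P G hG
  have := preservesFiniteColimits_lift P G hG
  refine faithful_of_isZero _ fun X hX => ?_
  have := Localization.essSurj P.isoModSerre.Q P.isoModSerre
  let e := P.isoModSerre.Q.objObjPreimageIso X
  refine IsZero.of_iso ?_ e.symm
  rw [ObjectProperty.SerreClassLocalization.isZero_obj_iff P.isoModSerre.Q P]
  refine h _ (IsZero.of_iso ?_ ((Localization.fac G hG P.isoModSerre.Q).app _).symm)
  exact IsZero.of_iso hX ((Localization.lift G hG P.isoModSerre.Q).mapIso e)

end SerreQuotient

section Hat

variable {R : Type w} [Category.{u} R] [Preadditive R] [EssentiallySmall.{u} R]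
  (M : R ⥤ AddCommGrpCat.{u}) [M.Additive]

instance : PreservesFiniteLimits (hat M) :=
  preservesFiniteLimits_lift _ (tilde M) (killed_inverted M)

instance : PreservesFiniteColimits (hat M) :=
  preservesFiniteColimits_lift _ (tilde M) (killed_inverted M)

instance : (hat M).Faithful :=
  faithful_lift _ (tilde M) (killed_inverted M) fun _ h => h

/-- `hat M` is induced by `tilde M`. -/
def QCompHat : (killed M).isoModSerre.Q ⋙ hat M ≅ tilde M :=
  Localization.fac (tilde M) (killed_inverted M) (killed M).isoModSerre.Q

end Hat

/-! ### Lifting a ring action to an abelian subcategory. -/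

section SingleObj

variable {E : Type w} [Category.{v} E] [Preadditive E] {S : Type u} [Ring S]

/-- A functor on the category with one object lifts along a faithful functor if its values do. -/
lemma exists_singleObj_functor {A : Type*} [Category* A] [Preadditive A] (I : E ⥤ A) [I.Additive]
    [I.Faithful] (N : SingleObj S ⥤ A) [N.Additive] (V : E)
    (e : I.obj V ≅ N.obj (SingleObj.star S))
    (h : ∀ f : N.obj (SingleObj.star S) ⟶ N.obj (SingleObj.star S),
      ∃ g : V ⟶ V, I.map g = e.hom ≫ f ≫ e.inv) :
    ∃ (F : SingleObj S ⥤ E) (_ : F.Additive), F.obj (SingleObj.star S) = V ∧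
      Nonempty (F ⋙ I ≅ N) := by
  -- The chosen lifts respect sums and products because `I` is faithful.
  choose g hg using h
  let F : SingleObj S ⥤ E :=
    { obj _ := V
      map {X Y} r := g (N.map r)
      map_id X := I.map_injective <| (hg _).trans <|
        (congrArg (fun t => e.hom ≫ t ≫ e.inv) (N.map_id X)).trans <|
          (congrArg (e.hom ≫ ·) (Category.id_comp e.inv)).trans <|
            e.hom_inv_id.trans (I.map_id V).symm
      map_comp r r' := I.map_injective (by
        rw [I.map_comp, hg, hg, hg, N.map_comp]
        simp only [Category.assoc, Iso.inv_hom_id_assoc]) }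
  have hF : F.Additive := ⟨fun {X Y r r'} => I.map_injective (by
    rw [I.map_add]
    refine (hg _).trans (Eq.trans ?_ (congrArg₂ (· + ·) (hg _) (hg _)).symm)
    rw [N.map_add]
    erw [Preadditive.add_comp, Preadditive.comp_add])⟩
  refine ⟨F, hF, rfl, ⟨NatIso.ofComponents (fun _ => e) fun {X Y} r => ?_⟩⟩
  change I.map (g (N.map r)) ≫ e.hom = e.hom ≫ N.map r
  rw [hg]
  simp only [Category.assoc, Iso.inv_hom_id]
  exact congrArg _ (Category.comp_id _)

end SingleObj

/-! ### Abelian generators and modules over rings. -/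

section Generator

variable {S : Type u} [Ring S] {A : Type u} [SmallCategory A] [Abelian A]

/-- The image of the ring in a quotient of its free abelian category is an abelian generator. -/
theorem isAbelianGenerator_of_isLocalization (P : ObjectProperty (FreeAb (SingleObj S)))
    [P.IsSerreClass] (K : FreeAb (SingleObj S) ⥤ A) [K.IsLocalization P.isoModSerre]
    [PreservesFiniteLimits K] [PreservesFiniteColimits K] :
    IsAbelianGenerator (K.obj ((FreeAb.of (SingleObj S)).obj (SingleObj.star S))) := by
  intro I V e hV
  have : K.Additive := K.additive_of_preserves_binary_products
  have : I.incl.Additive := I.incl.additive_of_preserves_binary_products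
  have : (FreeAb.of (SingleObj S)).Additive :=
    inferInstanceAs (AddClosure.of (SingleObj S) ⋙ AddClosure.toFreeAb (SingleObj S)).Additive
  obtain ⟨F, _, rfl, ⟨φ⟩⟩ := exists_singleObj_functor I.incl (FreeAb.of (SingleObj S) ⋙ K) V e hV
  obtain ⟨G, _, _, ⟨c⟩⟩ := FreeAb.exists_extension F
  obtain ⟨ψ⟩ := FreeAb.nonempty_iso (T := G ⋙ I.incl) (T' := K)
    (Functor.isoWhiskerRight c I.incl ≪≫ φ)
  -- `K ≅ G ⋙ I.incl` inverts these morphisms and the faithful functor `I.incl` reflects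
  -- isomorphisms.
  have hG : P.isoModSerre.IsInvertedBy G := by
    intro X Y f hf
    have := Localization.inverts K P.isoModSerre f hf
    have : IsIso (I.incl.map (G.map f)) := (NatIso.isIso_map_iff ψ f).2 this
    exact isIso_of_reflects_iso (G.map f) I.incl
  let s := Localization.lift G hG K
  let fac : K ⋙ s ≅ G := Localization.fac G hG K
  let η : s ⋙ I.incl ≅ 𝟭 A := Localization.liftNatIso K P.isoModSerre (K ⋙ s ⋙ I.incl) (K ⋙ 𝟭 A)
    (s ⋙ I.incl) (𝟭 A) (Functor.isoWhiskerRight fac I.incl ≪≫ ψ ≪≫ K.rightUnitor.symm)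
  let d := fac.app ((FreeAb.of (SingleObj S)).obj (SingleObj.star S)) ≪≫ c.app (SingleObj.star S)
  -- `ψ` is an unspecified isomorphism, so `d` need not be compatible with `η`. The discrepancy is
  -- an automorphism of the generator; it lifts to `B` by hypothesis, and composing `d` with the
  -- lift corrects it.
  obtain ⟨g, hg⟩ := hV (e.inv ≫ I.incl.map d.inv ≫ η.hom.app _)
  rw [Category.assoc, Iso.hom_inv_id_assoc] at hg
  have : IsIso (I.incl.map g) := by rw [hg]; infer_instance
  have : IsIso g := isIso_of_reflects_iso g I.incl
  refine ⟨s, η, d ≪≫ asIso g, ?_⟩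
  simp [hg]

variable {R : Type w} [Category.{u} R] [Preadditive R] [EssentiallySmall.{u} R]
  {M : R ⥤ AddCommGrpCat.{u}} [M.Additive]

lemma IsOverRing.isQuotientOverRing (h : IsOverRing M) : IsQuotientOverRing M := by
  obtain ⟨S, _, N, _, H, _⟩ := h
  exact ⟨S, _, killed N, inferInstance, ⟨H.symm⟩⟩

lemma IsQuotientOverRing.exists_isAbelianGenerator (h : IsQuotientOverRing M) :
    ∃ U : AssocCat M, IsAbelianGenerator U := by
  obtain ⟨S, _, P, _, ⟨H⟩⟩ := h
  have : (P.isoModSerre.Q ⋙ H.functor).IsLocalization P.isoModSerre :=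
    Functor.IsLocalization.of_equivalence_target P.isoModSerre.Q _ _ H (Iso.refl _)
  exact ⟨_, isAbelianGenerator_of_isLocalization P (P.isoModSerre.Q ⋙ H.functor)⟩

/-- If `A(M)` has an abelian generator, then `M` is over the endomorphism ring of the generator. -/
theorem isOverRing_of_isAbelianGenerator {U : AssocCat M} (hU : IsAbelianGenerator U) :
    IsOverRing M := by
  let F : SingleObj (End U) ⥤ AssocCat M :=
    { obj _ := U
      map r := (r : End U)
      map_id _ := rfl
      -- Composition in `SingleObj` and multiplication in `End U` both reverse the order, and the
      -- reversals cancel.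
      map_comp _ _ := rfl }
  have : F.Additive := ⟨rfl⟩
  have : (hat M).Additive := (hat M).additive_of_preserves_binary_products
  let N := F ⋙ hat M
  obtain ⟨G, _, _, ⟨c⟩⟩ := FreeAb.exists_extension F
  obtain ⟨ψ⟩ := FreeAb.nonempty_iso (T := tilde N) (T' := G ⋙ hat M)
    (ofCompTilde N ≪≫ (Functor.isoWhiskerRight c (hat M)).symm)
  have hG : (killed N).isoModSerre.IsInvertedBy G := by
    intro X Y f hf
    have := killed_inverted N f hf
    have : IsIso ((hat M).map (G.map f)) := (NatIso.isIso_map_iff ψ f).1 this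
    exact isIso_of_reflects_iso (G.map f) (hat M)
  let Q : FreeAb (SingleObj (End U)) ⥤ AssocCat N := (killed N).isoModSerre.Q
  let J : AssocCat N ⥤ AssocCat M := Localization.lift G hG Q
  let fac : Q ⋙ J ≅ G := Localization.fac G hG Q
  have : PreservesFiniteLimits J := preservesFiniteLimits_lift _ G hG
  have : PreservesFiniteColimits J := preservesFiniteColimits_lift _ G hG
  -- Whatever `G` kills is killed by `G ⋙ hat M`, hence by `tilde N` through `ψ`.
  have : J.Faithful := faithful_lift _ G hG fun X hX =>
    IsZero.of_iso (Functor.map_isZero (hat M) hX) (ψ.app X)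
  let j := (FreeAb.of (SingleObj (End U))).obj (SingleObj.star (End U))
  let κ : FreeAb.of (SingleObj (End U)) ⋙ Q ⋙ J ≅ F :=
    Functor.isoWhiskerLeft (FreeAb.of (SingleObj (End U))) fac ≪≫ c
  let e : J.obj (Q.obj j) ≅ U := κ.app (SingleObj.star (End U))
  obtain ⟨s, η, σ, hσ⟩ := hU { B := AssocCat N, incl := J } (Q.obj j) e fun f =>
    ⟨Q.map ((FreeAb.of (SingleObj (End U))).map
      (show SingleObj.star (End U) ⟶ SingleObj.star (End U) from (f : End U))),
      (NatIso.naturality_2 κ (show SingleObj.star (End U) ⟶ SingleObj.star (End U) from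
        (f : End U))).symm⟩
  obtain ⟨_, _⟩ := exact_of_section J s η
  let d : s.obj (J.obj (Q.obj j)) ≅ Q.obj j := s.mapIso e ≪≫ σ
  -- This is where the compatibility of `σ` with `η` enters: it puts the component of `η` at `J (Q
  -- j)` in the image of `J`.
  have hd : J.map d.hom = η.hom.app _ := by
    have h1 := η.hom.naturality e.hom
    dsimp at h1
    rw [← cancel_mono e.hom]
    simp only [d, Iso.trans_hom, Functor.mapIso_hom, J.map_comp, Category.assoc, hσ]
    exact h1
  -- Both functors are exact, so they need only be compared on the ring; after applying the faithful
  -- `J`, naturality of `d` becomes naturality of `η`.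
  obtain ⟨θ⟩ := FreeAb.nonempty_iso (T := Q ⋙ J ⋙ s) (T' := Q)
    (NatIso.ofComponents (fun _ => d) fun {X Y} r => J.map_injective (by
      have h1 := η.hom.naturality (J.map (Q.map ((FreeAb.of (SingleObj (End U))).map r)))
      rw [J.map_comp, J.map_comp, hd]
      exact h1))
  let ε : J ⋙ s ≅ 𝟭 (AssocCat N) := Localization.liftNatIso Q (killed N).isoModSerre
    (Q ⋙ J ⋙ s) (Q ⋙ 𝟭 _) (J ⋙ s) (𝟭 _) (θ ≪≫ Q.rightUnitor.symm)
  let : Localization.Lifting Q (killed N).isoModSerre (tilde N) (hat N) := ⟨QCompHat N⟩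
  let μ : J ⋙ hat M ≅ hat N := Localization.liftNatIso Q (killed N).isoModSerre
    (Q ⋙ J ⋙ hat M) (tilde N) (J ⋙ hat M) (hat N)
    (Functor.isoWhiskerRight fac (hat M) ≪≫ ψ.symm)
  exact ⟨End U, inferInstance, N, inferInstance, CategoryTheory.Equivalence.mk s J η.symm ε,
    ⟨Functor.isoWhiskerLeft s μ.symm ≪≫ Functor.isoWhiskerRight η (hat M) ≪≫ (hat M).leftUnitor⟩⟩

end Generator

end ModExact

end

theorem proposition5p1 {R : Type w} [Category.{u} R] [Preadditive R] [EssentiallySmall.{u} R]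
    (M : R ⥤ AddCommGrpCat.{u}) [M.Additive] :
    (ModExact.IsOverRing M ↔
      ∃ U : ModExact.AssocCat M, ModExact.IsAbelianGenerator U) ∧
    (ModExact.IsQuotientOverRing M ↔
      ∃ U : ModExact.AssocCat M, ModExact.IsAbelianGenerator U) :=
  ⟨⟨fun h => h.isQuotientOverRing.exists_isAbelianGenerator,
      fun ⟨_, hU⟩ => ModExact.isOverRing_of_isAbelianGenerator hU⟩,
    ⟨fun h => h.exists_isAbelianGenerator,
      fun ⟨_, hU⟩ => (ModExact.isOverRing_of_isAbelianGenerator hU).isQuotientOverRing⟩⟩
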